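/- **Notation.** Let $\Bbbk=\mathbb{C}(q^{1/2})$, $[m]=\frac{q^m-q^{-m}}{q-q^{-1}}$, and in any $\Bbbk$-algebra $[u,v]_t=uv-t\,vu$, $[u,v]=[u,v]_1$. Fix $n\ge 4$, $X\in\{C,D\}$ and $\epsilon=(\epsilon_1,\dots,\epsilon_n)\in\{0,1\}^n$. Put $\mathbb{I}=\{1,\dots,n\}$, $I=\{0,1,\dots,n-1\}$, $P=\bigoplus_{i\in\mathbb I}\mathbb{Z}\delta_i$ with $(\delta_i|\delta_j)=(-1)^{\epsilon_i}\delta_{ij}$, $q_i=(-1)^{\epsilon_i}q^{(-1)^{\epsilon_i}}$, $\mathbf{q}(\mu,\nu)=\prod_{i\in\mathbb I}q_i^{\mu_i\nu_i}$ for $\mu=\sum\mu_i\delta_i$, $\nu=\sum\nu_i\delta_i$; $\alpha_i=\delta_i-\delta_{i+1}$ for $1\le i\le n-1$, and $\alpha_0=-\delta_1-\delta_2$ if $X=D$, $\alpha_0=-2\delta_1$ if $X=C$. Let $I_{\rm odd}=\{i\in I: (\alpha_i|\alpha_i)=0\}$, $I_{\rm even}=I\setminus I_{\rm odd}$, and $p(i)=1$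 for $i\in I_{\rm odd}$, $p(i)=0$ for $i\in I_{\rm even}$. Let $d_i=q-q^{-1}$, except that $d_0=q^2-q^{-2}$ if $X=C$. Below, "$(e\to f)$" means that the same relation is imposed with every $e_i$ replaced by $f_i$ (likewise $(E\to F)$). **The algebra $\mathcal{U}_X(\epsilon)$** is the associative unital $\Bbbk$-algebra generated by $e_i,f_i,k_\mu$ ($i\in I,\mu\in P$) with relations ($k_i=k_{\alpha_i}$): * $k_0=1$ (for $\mu=0$), $k_{\mu+\mu'}=k_\mu k_{\mu'}$, $k_\mu e_ik_{-\mu}=\mathbf q(\mu,\alpha_i)e_i$, $k_\mu f_ik_{-\mu}=\mathbf q(\mu,\alpha_i)^{-1}f_i$; * $e_if_j-f_je_i=\delta_{ij}\,(k_i-k_i^{-1})/d_i$ for $i,j\in I$; * $[e_i,e_j]=0$ if $(\alpha_i|\alpha_j)=0$; $e_i^2=0$ if $i\in I_{\rm odd}$; and $(e\to f)$; * $e_i^2e_j-(-1)^{\epsilon_i}[2]e_ie_je_i+e_je_i^2=0$ if $i,j\in I\setminus\{0\}$, $|i-j|=1$, $\epsilon_i=\epsilon_{i+1}$; and $(e\to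 f)$; * $e_ie_{i-1}e_ie_{i+1}-e_ie_{i+1}e_ie_{i-1}+(-1)^{\epsilon_i}[2]e_ie_{i-1}e_{i+1}e_i-e_{i-1}e_ie_{i+1}e_i+e_{i+1}e_ie_{i-1}e_i=0$ if $2\le i\le n-2$, $\epsilon_i\ne\epsilon_{i+1}$; and $(e\to f)$; * if $X=D$ (and $(e\to f)$): $e_0^2e_2-(-1)^{\epsilon_2}[2]e_0e_2e_0+e_2e_0^2=0$ if $\epsilon_1=\epsilon_2$; $e_2^2e_0-(-1)^{\epsilon_2}[2]e_2e_0e_2+e_0e_2^2=0$ if $\epsilon_2=\epsilon_3$; $e_0e_1e_2-e_1e_0e_2+(-1)^{\epsilon_2}[2](e_1e_2e_0-e_0e_2e_1)+e_2e_0e_1-e_2e_1e_0=0$ if $\epsilon_1\ne\epsilon_2$; $e_0e_2e_3e_2-e_3e_2e_0e_2+(-1)^{\epsilon_3}[2]e_2e_3e_0e_2-e_2e_0e_2e_3+e_2e_3e_2e_0=0$ if $\epsilon_2\ne\epsilon_3$; * if $X=C$ (and $(e\to f)$): $e_0^2e_1-(q^2+q^{-2})e_0e_1e_0+e_1e_0^2=0$;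 $e_1^3e_0-[3]e_1^2e_0e_1+[3]e_1e_0e_1^2-e_0e_1^3=0$ if $\epsilon_1=\epsilon_2$; $[[[[e_2,e_1]_{q_2},e_0]_{q_1^2},[e_2,e_1]_{q_2}],e_1]=0$ if $\epsilon_1\ne\epsilon_2\ne\epsilon_3$; $[[[[[[e_3,e_2]_{q_3},e_1]_{q_2},e_0]_{q_1^2},e_1]_{q_1},e_2]_{q_2},e_1]=0$ if $\epsilon_1\ne\epsilon_2=\epsilon_3$. **The algebra $U_X(\epsilon)$** (Yamane's quantum superalgebra) is the associative unital $\Bbbk$-algebra generated by $E_i,F_i,K_\mu$ ($i\in I,\mu\in P$) with relations ($K_i=K_{\alpha_i}$): * $K_0=1$ (for $\mu=0$), $K_{\mu+\mu'}=K_\mu K_{\mu'}$, $K_\mu E_iK_\mu^{-1}=q^{(\mu|\alpha_i)}E_i$, $K_\mu F_iK_\mu^{-1}=q^{-(\mu|\alpha_i)}F_i$; * $E_iF_j-(-1)^{p(i)p(j)}F_jE_i=\delta_{ij}(-1)^{\epsilon_i}(K_i-K_i^{-1})/d_i$ for $i,j\in I$, where $\epsilon_i$ is read as $\epsilon_1$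 for $i=0$; * $E_i^2=0$ if $i\in I_{\rm odd}$; $E_iE_j-(-1)^{p(i)p(j)}E_jE_i=0$ if $(\alpha_i|\alpha_j)=0$; and $(E\to F)$; * $E_i^2E_j-[2]E_iE_jE_i+E_jE_i^2=0$ if $i,j\in I\setminus\{0\}$, $|i-j|=1$, $\epsilon_i=\epsilon_{i+1}$; and $(E\to F)$; * $[E_i,[[E_{i-1},E_i]_{(-1)^{p(i-1)}q},E_{i+1}]_{(-1)^{(p(i-1)+p(i))p(i+1)}q^{-1}}]_{(-1)^{p(i-1)+p(i)+p(i+1)}}=0$ if $2\le i\le n-2$, $\epsilon_i\ne\epsilon_{i+1}$; and $(E\to F)$; * if $X=D$ (and $(E\to F)$): $E_2^2E_0-[2]E_2E_0E_2+E_0E_2^2=0$ if $\epsilon_2=\epsilon_3$; $E_0^2E_2-[2]E_0E_2E_0+E_2E_0^2=0$ if $\epsilon_1=\epsilon_2$; $[E_2,[[E_3,E_2]_{(-1)^{p(3)}q},E_0]_{(-1)^{(p(3)+p(2))p(0)}q^{-1}}]_{(-1)^{p(3)+p(2)+p(0)}}=0$ if $\epsilon_2\ne\epsilon_3$; $E_0E_1E_2-E_1E_0E_2+(-1)^{\epsilon_2+\epsilon_3}[2](E_1E_2E_0-E_0E_2E_1)+E_2E_0E_1-E_2E_1E_0=0$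 if $\epsilon_1\ne\epsilon_2$; * if $X=C$ (and $(E\to F)$): $E_1^3E_0-[3]E_1^2E_0E_1+[3]E_1E_0E_1^2-E_0E_1^3=0$ if $\epsilon_1=\epsilon_2$; $E_0^2E_1-(q^2+q^{-2})E_0E_1E_0+E_1E_0^2=0$; $[[[[E_2,E_1]_{-q^{(-1)^{\epsilon_2}}},E_0]_{q^{2(-1)^{\epsilon_1}}},[E_2,E_1]_{-q^{(-1)^{\epsilon_2}}}],E_1]=0$ if $\epsilon_1\ne\epsilon_2\ne\epsilon_3$; $[[[[[[E_3,E_2]_{q^{(-1)^{\epsilon_3}}},E_1]_{(-1)^{p(3)}q^{(-1)^{\epsilon_2}}},E_0]_{q^{2(-1)^{\epsilon_1}}},E_1]_{(-1)^{p(3)+1}q^{(-1)^{\epsilon_1}}},E_2]_{q^{(-1)^{\epsilon_2}}},E_1]_{(-1)^{p(3)}}=0$ if $\epsilon_1\ne\epsilon_2=\epsilon_3$. **Extensions.** Let $\Sigma$ be the commutative $\Bbbk$-algebra generated by $\sigma_j$ ($j\in\mathbb I$) with $\sigma_j^2=1$ (the group algebra of $(\mathbb Z/2)^n$). It acts on $\mathcal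 U_X(\epsilon)$ by algebra automorphisms $\sigma_jk_\mu=k_\mu$, $\sigma_je_i=(-1)^{\epsilon_j(\delta_j|\alpha_i)}e_i$, $\sigma_jf_i=(-1)^{\epsilon_j(\delta_j|\alpha_i)}f_i$, and on $U_X(\epsilon)$ by the same formulas. Let $\mathcal U_X(\epsilon)[\sigma]$ and $U_X(\epsilon)[\sigma]$ be the corresponding semidirect (smash) products with $\Sigma$. Let $\mathscr X\subset U_X(\epsilon)[\sigma]$ be the $\Bbbk$-subalgebra generated by $E_i,F_i,K_i,\sigma_j$, and $\mathscr Y\subset\mathcal U_X(\epsilon)[\sigma]$ the $\Bbbk$-subalgebra generated by $e_i,f_i,k_i,\sigma_j$ ($i\in I$, $j\in\mathbb I$). **The map $\tau$.** Let $\mathbb I=\mathbb I^{(1)}\sqcup\dots\sqcup\mathbb I^{(l)}$ be the partition into the maximal intervals on which $\epsilon$ is constant, $\mathbb I^{(k)}=\{i_{k-1}+1,\dots,i_k\}$, $i_0=0$. Put $\sigma_{\le j}=\sigma_1\cdots\sigma_j$ and $\varsigma_i=\sigma_i\sigma_{i+1}$. For $1\le i\le n-1$ with $i\in\mathbb I^{(k)}$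 and $m=i-i_{k-1}$ define * if $(\epsilon_i,\epsilon_{i+1})=(0,0)$: $\tau(E_i)=e_i$, $\tau(F_i)=f_i$, $\tau(K_i)=k_i$; * if $(\epsilon_i,\epsilon_{i+1})=(0,1)$: $\tau(E_i)=e_i\sigma_{\le i}$, $\tau(F_i)=f_i\sigma_{\le i}\varsigma_i$, $\tau(K_i)=k_i\varsigma_i$; * if $(\epsilon_i,\epsilon_{i+1})=(1,1)$: $\tau(E_i)=e_i\varsigma_i^{m}$, $\tau(F_i)=-f_i\varsigma_i^{m-1}$, $\tau(K_i)=k_i\varsigma_i$; * if $(\epsilon_i,\epsilon_{i+1})=(1,0)$: $\tau(E_i)=e_i\sigma_{\le i}\varsigma_i^{m}$, $\tau(F_i)=(-1)^{m}f_i\sigma_{\le i}\varsigma_i^{m-1}$, $\tau(K_i)=k_i\varsigma_i$. If $X=D$, then $\tau(E_0),\tau(F_0),\tau(K_0)$ are given by the formulas for $i=1$ with $e_1,f_1,k_1$ replaced by $e_0,f_0,k_0$ (and the same signs and $\sigma$'s). If $X=C$, then $\tau(E_0)=(-1)^{\epsilon_1}e_0$, $\tau(F_0)=f_0$, $\tau(K_0)=k_0$.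 **Proposition.** For every $n\ge4$, $X\in\{C,D\}$ and $\epsilon\in\{0,1\}^n$, the map $\tau$ extends to an isomorphism of $\Bbbk$-algebras $\tau:\mathscr X\to\mathscr Y$ such that $\tau(\sigma_j)=\sigma_j$ for all $j\in\mathbb I$. -/

import Mathlib

noncomputable section

namespace QOsp

/-- The ground field `ℂ(q^{1/2})`. -/
def Kq : Type := RatFunc ℂ

instance : Field Kq := inferInstanceAs (Field (RatFunc ℂ))

/-- The variable `q^{1/2}`. -/
def qhalf : Kq := (RatFunc.X : RatFunc ℂ)

/-- `q = (q^{1/2})²`. -/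
def q : Kq := qhalf ^ 2

/-- The quantum integer `[m]`. -/
def qint (m : ℕ) : Kq := (q ^ m - (q ^ m)⁻¹) / (q - q⁻¹)

/-- The two Dynkin types. -/
inductive DType : Type
  | C : DType
  | D : DType

/-- The index set `𝕀 = {1 < 2 < ⋯ < n}`. -/
abbrev Idx (n : ℕ) : Type := ↥(Finset.Icc 1 n)

/-- Parity sequences `ε = (ε₁, …, εₙ)` with `εᵢ ∈ {0, 1}`. -/
abbrev Parity (n : ℕ) : Type := Idx n → Fin 2

/-- The weight lattice `P = ⨁_{i ∈ 𝕀} ℤ δᵢ`, an element being its family of coordinates. -/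
abbrev Wt (n : ℕ) : Type := Idx n → ℤ

variable {n : ℕ}

/-- The entry `ε_j` as a natural number `0` or `1`, for `1 ≤ j ≤ n` (and the unused value `0`
for other `j`). -/
def eps (ε : Parity n) (j : ℕ) : ℕ :=
  if h : j ∈ Finset.Icc 1 n then ((ε ⟨j, h⟩ : Fin 2) : ℕ) else 0

/-- The basis vector `δ_j` of `P`, for `1 ≤ j ≤ n`. -/
def δ (j : ℕ) : Wt n := fun l => if (l : ℕ) = j then 1 else 0

/-- The simple roots `α_i`, for `0 ≤ i ≤ n - 1`. -/
def α (X : DType) (i : ℕ) : Wt n :=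
  if i = 0 then
    match X with
    | DType.D => -δ 1 - δ 2
    | DType.C => -(2 • δ 1)
  else δ i - δ (i + 1)

/-- The bilinear form on `P` with `(δᵢ | δⱼ) = (-1)^{εᵢ} δᵢⱼ`. -/
def form (ε : Parity n) (μ ν : Wt n) : ℤ :=
  ∑ l : Idx n, (-1) ^ eps ε l * μ l * ν l

/-- `q_i = (-1)^{εᵢ} q^{(-1)^{εᵢ}}`. -/
def qi (ε : Parity n) (i : ℕ) : Kq := (-1) ^ eps ε i * q ^ ((-1 : ℤ) ^ eps ε i)

/-- The biadditive function `𝐪(μ, ν) = ∏ q_i^{μ_i ν_i}`. -/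
def bq (ε : Parity n) (μ ν : Wt n) : Kq := ∏ l : Idx n, qi ε l ^ (μ l * ν l)

/-- The parity `p(i)` of the index `i ∈ I`: it is `1` if `(αᵢ | αᵢ) = 0` (that is, `i ∈ I_odd`)
and `0` otherwise. -/
def p (X : DType) (ε : Parity n) (i : ℕ) : ℕ :=
  if form ε (α X i) (α X i) = 0 then 1 else 0

/-- The denominator in the commutation relation of `e_i` and `f_i`. -/
def den (X : DType) (i : ℕ) : Kq :=
  match X with
  | DType.D => q - q⁻¹
  | DType.C => if i = 0 then q ^ 2 - (q ^ 2)⁻¹ else q - q⁻¹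

/-- Symbols for the generators: `e_i`, `f_i` with `i ∈ I = {0, …, n - 1}` and `k_μ` with `μ ∈ P`. -/
inductive Gen (n : ℕ) : Type
  | e : Fin n → Gen n
  | f : Fin n → Gen n
  | k : Wt n → Gen n

/-- The free algebra on the symbols. -/
abbrev Free (n : ℕ) : Type := FreeAlgebra Kq (Gen n)

/-- The symbol `e_i` in the free algebra for `i ∈ I = {0, …, n - 1}` (and `0` otherwise). -/
def fe (i : ℕ) : Free n := if h : i < n then FreeAlgebra.ι Kq (Gen.e ⟨i, h⟩) else 0

/-- The symbol `f_i` in the free algebra for `i ∈ I = {0, …, n - 1}` (and `0` otherwise). -/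
def ff (i : ℕ) : Free n := if h : i < n then FreeAlgebra.ι Kq (Gen.f ⟨i, h⟩) else 0

/-- The symbol `k_μ` in the free algebra. -/
def fk (μ : Wt n) : Free n := FreeAlgebra.ι Kq (Gen.k μ)

section Relations

variable {A : Type} [Ring A] [Algebra Kq A]

/-- `[u, v]_t = uv - t vu`. -/
def br (u v : A) (t : Kq) : A := u * v - t • (v * u)

/-- The relators of the generalized quantum group of type `X` that involve only the family
`x = (x_i)_{i ∈ I}`; it is used for `x = e` and for `x = f`. -/
inductive GQSerre (X : DType) (ε : Parity n) (x : ℕ → A) : A → Prop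
  | comm (i j : ℕ) (hi : i < n) (hj : j < n) (h : form ε (α X i) (α X j) = 0) :
      GQSerre X ε x (br (x i) (x j) 1)
  | sq (i : ℕ) (hi : i < n) (h : form ε (α X i) (α X i) = 0) :
      GQSerre X ε x (x i * x i)
  | serre (i j : ℕ) (hi : 1 ≤ i) (hi' : i < n) (hj : 1 ≤ j) (hj' : j < n)
      (hij : i + 1 = j ∨ j + 1 = i) (h : eps ε i = eps ε (i + 1)) :
      GQSerre X ε x (x i * x i * x j - ((-1) ^ eps ε i * qint 2) • (x i * x j * x i)
        + x j * x i * x i)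
  | quartic (i : ℕ) (hi : 2 ≤ i) (hi' : i + 2 ≤ n) (h : eps ε i ≠ eps ε (i + 1)) :
      GQSerre X ε x (x i * x (i - 1) * x i * x (i + 1) - x i * x (i + 1) * x i * x (i - 1)
        + ((-1) ^ eps ε i * qint 2) • (x i * x (i - 1) * x (i + 1) * x i)
        - x (i - 1) * x i * x (i + 1) * x i + x (i + 1) * x i * x (i - 1) * x i)
  | d_serre02 (hX : X = DType.D) (h : eps ε 1 = eps ε 2) :
      GQSerre X ε x (x 0 * x 0 * x 2 - ((-1) ^ eps ε 2 * qint 2) • (x 0 * x 2 * x 0)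
        + x 2 * x 0 * x 0)
  | d_serre20 (hX : X = DType.D) (h : eps ε 2 = eps ε 3) :
      GQSerre X ε x (x 2 * x 2 * x 0 - ((-1) ^ eps ε 2 * qint 2) • (x 2 * x 0 * x 2)
        + x 0 * x 2 * x 2)
  | d_cubic (hX : X = DType.D) (h : eps ε 1 ≠ eps ε 2) :
      GQSerre X ε x (x 0 * x 1 * x 2 - x 1 * x 0 * x 2
        + ((-1) ^ eps ε 2 * qint 2) • (x 1 * x 2 * x 0 - x 0 * x 2 * x 1)
        + x 2 * x 0 * x 1 - x 2 * x 1 * x 0)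
  | d_quartic (hX : X = DType.D) (h : eps ε 2 ≠ eps ε 3) :
      GQSerre X ε x (x 0 * x 2 * x 3 * x 2 - x 3 * x 2 * x 0 * x 2
        + ((-1) ^ eps ε 3 * qint 2) • (x 2 * x 3 * x 0 * x 2)
        - x 2 * x 0 * x 2 * x 3 + x 2 * x 3 * x 2 * x 0)
  | c_serre01 (hX : X = DType.C) :
      GQSerre X ε x (x 0 * x 0 * x 1 - (q ^ 2 + (q ^ 2)⁻¹) • (x 0 * x 1 * x 0)
        + x 1 * x 0 * x 0)
  | c_serre10 (hX : X = DType.C) (h : eps ε 1 = eps ε 2) :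
      GQSerre X ε x (x 1 * x 1 * x 1 * x 0 - qint 3 • (x 1 * x 1 * x 0 * x 1)
        + qint 3 • (x 1 * x 0 * x 1 * x 1) - x 0 * x 1 * x 1 * x 1)
  | c_sextic (hX : X = DType.C) (h : eps ε 1 ≠ eps ε 2) (h' : eps ε 2 ≠ eps ε 3) :
      GQSerre X ε x
        (br (br (br (br (x 2) (x 1) (qi ε 2)) (x 0) (qi ε 1 ^ 2)) (br (x 2) (x 1) (qi ε 2)) 1)
          (x 1) 1)
  | c_septic (hX : X = DType.C) (h : eps ε 1 ≠ eps ε 2) (h' : eps ε 2 = eps ε 3) :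
      GQSerre X ε x
        (br (br (br (br (br (br (x 3) (x 2) (qi ε 3)) (x 1) (qi ε 2)) (x 0) (qi ε 1 ^ 2))
          (x 1) (qi ε 1)) (x 2) (qi ε 2)) (x 1) 1)

/-- The relators of Yamane's quantum superalgebra of type `X` that involve only the family
`x = (x_i)_{i ∈ I}`; it is used for `x = E` and for `x = F`. -/
inductive YQSerre (X : DType) (ε : Parity n) (x : ℕ → A) : A → Prop
  | sq (i : ℕ) (hi : i < n) (h : form ε (α X i) (α X i) = 0) :
      YQSerre X ε x (x i * x i)
  | comm (i j : ℕ) (hi : i < n) (hj : j < n) (h : form ε (α X i) (α X j) = 0) :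
      YQSerre X ε x (br (x i) (x j) ((-1) ^ (p X ε i * p X ε j)))
  | serre (i j : ℕ) (hi : 1 ≤ i) (hi' : i < n) (hj : 1 ≤ j) (hj' : j < n)
      (hij : i + 1 = j ∨ j + 1 = i) (h : eps ε i = eps ε (i + 1)) :
      YQSerre X ε x (x i * x i * x j - qint 2 • (x i * x j * x i) + x j * x i * x i)
  | quartic (i : ℕ) (hi : 2 ≤ i) (hi' : i + 2 ≤ n) (h : eps ε i ≠ eps ε (i + 1)) :
      YQSerre X ε x
        (br (x i)
          (br (br (x (i - 1)) (x i) ((-1) ^ p X ε (i - 1) * q)) (x (i + 1))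
            ((-1) ^ ((p X ε (i - 1) + p X ε i) * p X ε (i + 1)) * q⁻¹))
          ((-1) ^ (p X ε (i - 1) + p X ε i + p X ε (i + 1))))
  | d_serre20 (hX : X = DType.D) (h : eps ε 2 = eps ε 3) :
      YQSerre X ε x (x 2 * x 2 * x 0 - qint 2 • (x 2 * x 0 * x 2) + x 0 * x 2 * x 2)
  | d_serre02 (hX : X = DType.D) (h : eps ε 1 = eps ε 2) :
      YQSerre X ε x (x 0 * x 0 * x 2 - qint 2 • (x 0 * x 2 * x 0) + x 2 * x 0 * x 0)
  | d_quartic (hX : X = DType.D) (h : eps ε 2 ≠ eps ε 3) :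
      YQSerre X ε x
        (br (x 2)
          (br (br (x 3) (x 2) ((-1) ^ p X ε 3 * q)) (x 0)
            ((-1) ^ ((p X ε 3 + p X ε 2) * p X ε 0) * q⁻¹))
          ((-1) ^ (p X ε 3 + p X ε 2 + p X ε 0)))
  | d_cubic (hX : X = DType.D) (h : eps ε 1 ≠ eps ε 2) :
      YQSerre X ε x (x 0 * x 1 * x 2 - x 1 * x 0 * x 2
        + ((-1) ^ (eps ε 2 + eps ε 3) * qint 2) • (x 1 * x 2 * x 0 - x 0 * x 2 * x 1)
        + x 2 * x 0 * x 1 - x 2 * x 1 * x 0)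
  | c_serre10 (hX : X = DType.C) (h : eps ε 1 = eps ε 2) :
      YQSerre X ε x (x 1 * x 1 * x 1 * x 0 - qint 3 • (x 1 * x 1 * x 0 * x 1)
        + qint 3 • (x 1 * x 0 * x 1 * x 1) - x 0 * x 1 * x 1 * x 1)
  | c_serre01 (hX : X = DType.C) :
      YQSerre X ε x (x 0 * x 0 * x 1 - (q ^ 2 + (q ^ 2)⁻¹) • (x 0 * x 1 * x 0)
        + x 1 * x 0 * x 0)
  | c_sextic (hX : X = DType.C) (h : eps ε 1 ≠ eps ε 2) (h' : eps ε 2 ≠ eps ε 3) :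
      YQSerre X ε x
        (br (br (br (br (x 2) (x 1) (-q ^ ((-1 : ℤ) ^ eps ε 2)))
            (x 0) (q ^ (2 * (-1 : ℤ) ^ eps ε 1)))
          (br (x 2) (x 1) (-q ^ ((-1 : ℤ) ^ eps ε 2))) 1) (x 1) 1)
  | c_septic (hX : X = DType.C) (h : eps ε 1 ≠ eps ε 2) (h' : eps ε 2 = eps ε 3) :
      YQSerre X ε x
        (br (br (br (br (br (br (x 3) (x 2) (q ^ ((-1 : ℤ) ^ eps ε 3)))
          (x 1) ((-1) ^ p X ε 3 * q ^ ((-1 : ℤ) ^ eps ε 2)))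
          (x 0) (q ^ (2 * (-1 : ℤ) ^ eps ε 1)))
          (x 1) ((-1) ^ (p X ε 3 + 1) * q ^ ((-1 : ℤ) ^ eps ε 1)))
          (x 2) (q ^ ((-1 : ℤ) ^ eps ε 2)))
          (x 1) ((-1) ^ p X ε 3))

end Relations

/-- The defining relations of the generalized quantum group of type `X` associated to `ε`. -/
inductive GQRel (X : DType) (ε : Parity n) : Free n → Free n → Prop
  | k_zero : GQRel X ε (fk 0) 1
  | k_add (μ ν : Wt n) : GQRel X ε (fk (μ + ν)) (fk μ * fk ν)
  | k_e (i : ℕ) (hi : i < n) (μ : Wt n) :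
      GQRel X ε (fk μ * fe i * fk (-μ)) (bq ε μ (α X i) • fe i)
  | k_f (i : ℕ) (hi : i < n) (μ : Wt n) :
      GQRel X ε (fk μ * ff i * fk (-μ)) ((bq ε μ (α X i))⁻¹ • ff i)
  | e_f (i j : ℕ) (hi : i < n) (hj : j < n) :
      GQRel X ε (fe i * ff j - ff j * fe i)
        (if i = j then (den X i)⁻¹ • (fk (α X i) - fk (-α X i)) else 0)
  | serre_e (r : Free n) (hr : GQSerre X ε fe r) : GQRel X ε r 0
  | serre_f (r : Free n) (hr : GQSerre X ε ff r) : GQRel X ε r 0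

/-- The defining relations of Yamane's quantum superalgebra of type `X` associated to `ε`. -/
inductive YQRel (X : DType) (ε : Parity n) : Free n → Free n → Prop
  | k_zero : YQRel X ε (fk 0) 1
  | k_add (μ ν : Wt n) : YQRel X ε (fk (μ + ν)) (fk μ * fk ν)
  | k_e (i : ℕ) (hi : i < n) (μ : Wt n) :
      YQRel X ε (fk μ * fe i * fk (-μ)) (q ^ form ε μ (α X i) • fe i)
  | k_f (i : ℕ) (hi : i < n) (μ : Wt n) :
      YQRel X ε (fk μ * ff i * fk (-μ)) (q ^ (-form ε μ (α X i)) • ff i)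
  | e_f (i j : ℕ) (hi : i < n) (hj : j < n) :
      YQRel X ε (fe i * ff j - ((-1) ^ (p X ε i * p X ε j) : Kq) • (ff j * fe i))
        (if i = j then
          ((-1) ^ (if i = 0 then eps ε 1 else eps ε i) * (den X i)⁻¹) •
            (fk (α X i) - fk (-α X i))
        else 0)
  | serre_e (r : Free n) (hr : YQSerre X ε fe r) : YQRel X ε r 0
  | serre_f (r : Free n) (hr : YQSerre X ε ff r) : YQRel X ε r 0

/-- The algebra presented by the symbols and a set `r` of relations. -/
def Pres (r : Free n → Free n → Prop) : Type := RingQuot r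

instance (r : Free n → Free n → Prop) : Ring (Pres r) := inferInstanceAs (Ring (RingQuot r))

instance (r : Free n → Free n → Prop) : Algebra Kq (Pres r) :=
  inferInstanceAs (Algebra Kq (RingQuot r))

/-- The quotient map from the free algebra. -/
def Pres.mk (r : Free n → Free n → Prop) : Free n →ₐ[Kq] Pres r := RingQuot.mkAlgHom Kq r

theorem Pres.mk_surjective (r : Free n → Free n → Prop) : Function.Surjective (Pres.mk r) :=
  RingQuot.mkAlgHom_surjective Kq r

theorem Pres.mk_rel {r : Free n → Free n → Prop} {a b : Free n} (h : r a b) :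
    Pres.mk r a = Pres.mk r b := RingQuot.mkAlgHom_rel Kq h

/-- The universal property of the presented algebra. -/
def Pres.lift {r : Free n → Free n → Prop} {B : Type} [Ring B] [Algebra Kq B] (φ : Free n →ₐ[Kq] B)
    (h : ∀ a b, r a b → φ a = φ b) : Pres r →ₐ[Kq] B :=
  RingQuot.liftAlgHom Kq ⟨φ, fun {a b} hab => h a b hab⟩

theorem Pres.lift_mk {r : Free n → Free n → Prop} {B : Type} [Ring B] [Algebra Kq B]
    (φ : Free n →ₐ[Kq] B) (h : ∀ a b, r a b → φ a = φ b) (a : Free n) :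
    Pres.lift φ h (Pres.mk r a) = φ a :=
  RingQuot.liftAlgHom_mkAlgHom_apply Kq φ (fun {a b} hab => h a b hab) a

/-- The generalized quantum group `𝒰_X(ε)`. -/
abbrev GQ (X : DType) (ε : Parity n) : Type := Pres (GQRel X ε)

/-- Yamane's quantum superalgebra `U_X(ε)`. -/
abbrev YQ (X : DType) (ε : Parity n) : Type := Pres (YQRel X ε)

/-! The group generated by commuting involutions `σ_1, …, σ_n`, and its action. -/

/-- The group `(ℤ/2)ⁿ` on commuting involutions `σ_1, …, σ_n`, written as `{1, -1}ⁿ`. The bialgebra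
`Σ` is its group algebra over `Kq`. -/
abbrev SGroup (n : ℕ) : Type := Idx n → ℤˣ

/-- The generator `σ_j` of the group, for `1 ≤ j ≤ n`. -/
def sg (j : ℕ) : SGroup n := fun l => if (l : ℕ) = j then -1 else 1

/-- The sign by which a group element acts on `e_i` and `f_i`; for `σ_j` it is
`(-1)^{ε_j (δ_j | α_i)}`. -/
def chi (X : DType) (ε : Parity n) (i : ℕ) : SGroup n →* ℤˣ where
  toFun g := ∏ j : Idx n, g j ^ ((eps ε j : ℤ) * form ε (δ j) (α X i))
  map_one' := by simp
  map_mul' g h := by simp [mul_zpow, Finset.prod_mul_distrib]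

theorem chi_sg (X : DType) (ε : Parity n) (i : ℕ) (j : Idx n) :
    chi X ε i (sg j) = (-1) ^ ((eps ε j : ℤ) * form ε (δ j) (α X i)) := by
  change ∏ l : Idx n, sg (j : ℕ) l ^ ((eps ε l : ℤ) * form ε (δ l) (α X i)) = _
  unfold sg
  rw [Finset.prod_eq_single j]
  · simp
  · intro l _ hl
    have : (l : ℕ) ≠ j := fun h => hl (Subtype.ext h)
    simp [this]
  · simp

/-- The endomorphism of the free algebra with `e_i ↦ c_i e_i`, `f_i ↦ c_i f_i`, `k_μ ↦ k_μ`. -/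
def twist (c : ℕ → ℤˣ) : Free n →ₐ[Kq] Free n :=
  FreeAlgebra.lift Kq fun
    | Gen.e i => (((c i : ℤˣ) : ℤ) : Kq) • FreeAlgebra.ι Kq (Gen.e i)
    | Gen.f i => (((c i : ℤˣ) : ℤ) : Kq) • FreeAlgebra.ι Kq (Gen.f i)
    | Gen.k μ => FreeAlgebra.ι Kq (Gen.k μ)

theorem twist_fe (c : ℕ → ℤˣ) (i : ℕ) :
    twist c (fe i : Free n) = (((c i : ℤˣ) : ℤ) : Kq) • fe i := by
  unfold fe twist; split_ifs <;> simp

theorem twist_ff (c : ℕ → ℤˣ) (i : ℕ) :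
    twist c (ff i : Free n) = (((c i : ℤˣ) : ℤ) : Kq) • ff i := by
  unfold ff twist; split_ifs <;> simp

theorem twist_fk (c : ℕ → ℤˣ) (μ : Wt n) : twist c (fk μ) = fk μ := by
  unfold fk twist; simp

section Homogeneity

variable {A B : Type} [Ring A] [Algebra Kq A] [Ring B] [Algebra Kq B]

theorem br_smul (a b t : Kq) (u v : A) : br (a • u) (b • v) t = (a * b) • br u v t := by
  simp only [br, smul_mul_assoc, mul_smul_comm, smul_smul, smul_sub]
  congr 2 <;> ring

theorem map_br (φ : A →ₐ[Kq] B) (u v : A) (t : Kq) : φ (br u v t) = br (φ u) (φ v) t := by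
  simp [br]

theorem GQSerre.homogeneous {X : DType} {ε : Parity n} {x : ℕ → A} {r : A}
    (hr : GQSerre X ε x r) (φ : A →ₐ[Kq] A) (c : ℕ → Kq) (h : ∀ i, φ (x i) = c i • x i) :
    ∃ d : Kq, φ r = d • r := by
  induction hr with
  | comm i j => exact ⟨c i * c j, by simp only [map_br, h, br_smul]⟩
  | sq i => exact ⟨c i * c i, by simp only [map_mul, h, smul_mul_smul_comm]⟩
  | serre i j =>
    refine ⟨c i * c i * c j, ?_⟩
    simp only [map_sub, map_add, map_mul, map_smul, h, smul_mul_assoc, mul_smul_comm]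
    module
  | quartic i =>
    refine ⟨c i * c (i - 1) * c i * c (i + 1), ?_⟩
    simp only [map_sub, map_add, map_mul, map_smul, h, smul_mul_assoc, mul_smul_comm]
    module
  | d_serre02 =>
    refine ⟨c 0 * c 0 * c 2, ?_⟩
    simp only [map_sub, map_add, map_mul, map_smul, h, smul_mul_assoc, mul_smul_comm]
    module
  | d_serre20 =>
    refine ⟨c 2 * c 2 * c 0, ?_⟩
    simp only [map_sub, map_add, map_mul, map_smul, h, smul_mul_assoc, mul_smul_comm]
    module
  | d_cubic =>
    refine ⟨c 0 * c 1 * c 2, ?_⟩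
    simp only [map_sub, map_add, map_mul, map_smul, h, smul_mul_assoc, mul_smul_comm]
    module
  | d_quartic =>
    refine ⟨c 0 * c 2 * c 3 * c 2, ?_⟩
    simp only [map_sub, map_add, map_mul, map_smul, h, smul_mul_assoc, mul_smul_comm]
    module
  | c_serre01 =>
    refine ⟨c 0 * c 0 * c 1, ?_⟩
    simp only [map_sub, map_add, map_mul, map_smul, h, smul_mul_assoc, mul_smul_comm]
    module
  | c_serre10 =>
    refine ⟨c 1 * c 1 * c 1 * c 0, ?_⟩
    simp only [map_sub, map_add, map_mul, map_smul, h, smul_mul_assoc, mul_smul_comm]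
    module
  | c_sextic => exact ⟨_, by simp only [map_br, h, br_smul]; rfl⟩
  | c_septic => exact ⟨_, by simp only [map_br, h, br_smul]; rfl⟩

theorem YQSerre.homogeneous {X : DType} {ε : Parity n} {x : ℕ → A} {r : A}
    (hr : YQSerre X ε x r) (φ : A →ₐ[Kq] A) (c : ℕ → Kq) (h : ∀ i, φ (x i) = c i • x i) :
    ∃ d : Kq, φ r = d • r := by
  induction hr with
  | comm i j => exact ⟨c i * c j, by simp only [map_br, h, br_smul]⟩
  | sq i => exact ⟨c i * c i, by simp only [map_mul, h, smul_mul_smul_comm]⟩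
  | serre i j =>
    refine ⟨c i * c i * c j, ?_⟩
    simp only [map_sub, map_add, map_mul, map_smul, h, smul_mul_assoc, mul_smul_comm]
    module
  | quartic i => exact ⟨_, by simp only [map_br, h, br_smul]; rfl⟩
  | d_serre02 =>
    refine ⟨c 0 * c 0 * c 2, ?_⟩
    simp only [map_sub, map_add, map_mul, map_smul, h, smul_mul_assoc, mul_smul_comm]
    module
  | d_serre20 =>
    refine ⟨c 2 * c 2 * c 0, ?_⟩
    simp only [map_sub, map_add, map_mul, map_smul, h, smul_mul_assoc, mul_smul_comm]
    module
  | d_cubic =>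
    refine ⟨c 0 * c 1 * c 2, ?_⟩
    simp only [map_sub, map_add, map_mul, map_smul, h, smul_mul_assoc, mul_smul_comm]
    module
  | d_quartic => exact ⟨_, by simp only [map_br, h, br_smul]; rfl⟩
  | c_serre01 =>
    refine ⟨c 0 * c 0 * c 1, ?_⟩
    simp only [map_sub, map_add, map_mul, map_smul, h, smul_mul_assoc, mul_smul_comm]
    module
  | c_serre10 =>
    refine ⟨c 1 * c 1 * c 1 * c 0, ?_⟩
    simp only [map_sub, map_add, map_mul, map_smul, h, smul_mul_assoc, mul_smul_comm]
    module
  | c_sextic => exact ⟨_, by simp only [map_br, h, br_smul]; rfl⟩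
  | c_septic => exact ⟨_, by simp only [map_br, h, br_smul]; rfl⟩

end Homogeneity

theorem unit_sq (u : ℤˣ) : (((u : ℤ) : Kq)) * ((u : ℤ) : Kq) = 1 := by
  rcases Int.units_eq_one_or u with rfl | rfl <;> simp

/-- Compatibility of a set of relations with the sign automorphisms. -/
def Stable (X : DType) (ε : Parity n) (r : Free n → Free n → Prop) : Prop :=
  ∀ (g : SGroup n) (a b : Free n), r a b →
    Pres.mk r (twist (fun i => chi X ε i g) a) =
      Pres.mk r (twist (fun i => chi X ε i g) b)

theorem gq_stable (X : DType) (ε : Parity n) : Stable X ε (GQRel X ε) := by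
  intro g a b hab
  have h0 := Pres.mk_rel hab
  cases hab with
  | k_zero => simpa [twist_fk] using h0
  | k_add μ ν => simpa [twist_fk] using h0
  | k_e i hi μ =>
    simp only [map_mul, map_smul, twist_fk, twist_fe, mul_smul_comm, smul_mul_assoc] at h0 ⊢
    rw [h0, smul_comm]
  | k_f i hi μ =>
    simp only [map_mul, map_smul, twist_fk, twist_ff, mul_smul_comm, smul_mul_assoc] at h0 ⊢
    rw [h0, smul_comm]
  | e_f i j hi hj =>
    by_cases hij : i = j
    · subst hij
      rw [if_pos rfl] at h0 ⊢
      simp only [map_sub, map_mul, map_smul, twist_fk, twist_fe, twist_ff, smul_mul_smul_comm,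
        unit_sq, one_smul] at h0 ⊢
      exact h0
    · rw [if_neg hij] at h0 ⊢
      simp only [map_sub, map_mul, map_smul, twist_fe, twist_ff, smul_mul_smul_comm,
        map_zero] at h0 ⊢
      rw [mul_comm (((chi X ε j g : ℤˣ) : ℤ) : Kq), ← smul_sub, h0, smul_zero]
  | serre_e r hr =>
    obtain ⟨d, hd⟩ := hr.homogeneous (twist fun i => chi X ε i g) _ (fun i => twist_fe _ i)
    rw [hd, map_smul, h0]; simp
  | serre_f r hr =>
    obtain ⟨d, hd⟩ := hr.homogeneous (twist fun i => chi X ε i g) _ (fun i => twist_ff _ i)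
    rw [hd, map_smul, h0]; simp

theorem yq_stable (X : DType) (ε : Parity n) : Stable X ε (YQRel X ε) := by
  intro g a b hab
  have h0 := Pres.mk_rel hab
  cases hab with
  | k_zero => simpa [twist_fk] using h0
  | k_add μ ν => simpa [twist_fk] using h0
  | k_e i hi μ =>
    simp only [map_mul, map_smul, twist_fk, twist_fe, mul_smul_comm, smul_mul_assoc] at h0 ⊢
    rw [h0, smul_comm]
  | k_f i hi μ =>
    simp only [map_mul, map_smul, twist_fk, twist_ff, mul_smul_comm, smul_mul_assoc] at h0 ⊢
    rw [h0, smul_comm]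
  | e_f i j hi hj =>
    by_cases hij : i = j
    · subst hij
      rw [if_pos rfl] at h0 ⊢
      simp only [map_sub, map_mul, map_smul, twist_fk, twist_fe, twist_ff, smul_mul_smul_comm,
        unit_sq, one_smul] at h0 ⊢
      exact h0
    · rw [if_neg hij] at h0 ⊢
      simp only [map_sub, map_mul, map_smul, twist_fe, twist_ff, smul_mul_smul_comm,
        map_zero] at h0 ⊢
      rw [mul_comm (((chi X ε j g : ℤˣ) : ℤ) : Kq), smul_comm ((-1 : Kq) ^ _), ← smul_sub, h0,
        smul_zero]
  | serre_e r hr =>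
    obtain ⟨d, hd⟩ := hr.homogeneous (twist fun i => chi X ε i g) _ (fun i => twist_fe _ i)
    rw [hd, map_smul, h0]; simp
  | serre_f r hr =>
    obtain ⟨d, hd⟩ := hr.homogeneous (twist fun i => chi X ε i g) _ (fun i => twist_ff _ i)
    rw [hd, map_smul, h0]; simp

/-- The endomorphism of the quotient algebra by which a group element acts: it multiplies the
classes of `e_i`, `f_i` by the sign `chi X ε i g` and fixes the classes of `k_μ`. -/
def actHom (X : DType) (ε : Parity n) {r : Free n → Free n → Prop} (h : Stable X ε r)
    (g : SGroup n) : Pres r →ₐ[Kq] Pres r :=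
  Pres.lift ((Pres.mk r).comp (twist fun i => chi X ε i g)) (h g)

theorem actHom_mk (X : DType) (ε : Parity n) {r : Free n → Free n → Prop} (h : Stable X ε r)
    (g : SGroup n) (a : Free n) :
    actHom X ε h g (Pres.mk r a) =
      Pres.mk r (twist (fun i => chi X ε i g) a) := by
  exact Pres.lift_mk _ _ a

theorem twist_one : (twist (fun _ => 1) : Free n →ₐ[Kq] Free n) = AlgHom.id Kq _ := by
  ext s; cases s <;> simp [twist]

theorem twist_mul (c d : ℕ → ℤˣ) :
    (twist (fun i => c i * d i) : Free n →ₐ[Kq] Free n) = (twist c).comp (twist d) := by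
  ext s; cases s <;> simp [twist, smul_smul, mul_comm]

/-- The action of the group by algebra automorphisms on the quotient algebra. -/
@[reducible] def action (X : DType) (ε : Parity n) {r : Free n → Free n → Prop}
    (h : Stable X ε r) : MulSemiringAction (SGroup n) (Pres r) where
  smul g u := actHom X ε h g u
  one_smul u := by
    obtain ⟨a, rfl⟩ := Pres.mk_surjective r u
    change actHom X ε h 1 _ = _
    rw [actHom_mk]; simp [twist_one]
  mul_smul g g' u := by
    obtain ⟨a, rfl⟩ := Pres.mk_surjective r u
    change actHom X ε h (g * g') _ = actHom X ε h g (actHom X ε h g' _)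
    simp only [actHom_mk, map_mul, twist_mul, AlgHom.comp_apply]
  smul_zero g := map_zero (actHom X ε h g)
  smul_add g := map_add (actHom X ε h g)
  smul_one g := map_one (actHom X ε h g)
  smul_mul g := map_mul (actHom X ε h g)

instance gqAction (X : DType) (ε : Parity n) : MulSemiringAction (SGroup n) (GQ X ε) :=
  action X ε (gq_stable X ε)

instance yqAction (X : DType) (ε : Parity n) : MulSemiringAction (SGroup n) (YQ X ε) :=
  action X ε (yq_stable X ε)

instance gqComm (X : DType) (ε : Parity n) : SMulCommClass (SGroup n) Kq (GQ X ε) where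
  smul_comm g t u := map_smul (actHom X ε (gq_stable X ε) g) t u

instance yqComm (X : DType) (ε : Parity n) : SMulCommClass (SGroup n) Kq (YQ X ε) where
  smul_comm g t u := map_smul (actHom X ε (yq_stable X ε) g) t u

/-- The semidirect product `𝒰_X(ε)[σ]` of `𝒰_X(ε)` and the group algebra `Σ`: its elements are the
finite sums of `u g` with `u ∈ 𝒰_X(ε)` and `g` a group element, and `g u = (g • u) g`. -/
abbrev GQσ (X : DType) (ε : Parity n) : Type := SkewMonoidAlgebra (GQ X ε) (SGroup n)

/-- The semidirect product `U_X(ε)[σ]` of `U_X(ε)` and the group algebra `Σ`. -/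
abbrev YQσ (X : DType) (ε : Parity n) : Type := SkewMonoidAlgebra (YQ X ε) (SGroup n)

variable (X : DType) (ε : Parity n)

/-- The generator `e_i` in `𝒰_X(ε)[σ]`. -/
def e (i : ℕ) : GQσ X ε := SkewMonoidAlgebra.single 1 (Pres.mk (GQRel X ε) (fe i))

/-- The generator `f_i` in `𝒰_X(ε)[σ]`. -/
def f (i : ℕ) : GQσ X ε := SkewMonoidAlgebra.single 1 (Pres.mk (GQRel X ε) (ff i))

/-- The element `k_i = k_{α_i}` in `𝒰_X(ε)[σ]`. -/
def k (i : ℕ) : GQσ X ε :=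
  SkewMonoidAlgebra.single 1 (Pres.mk (GQRel X ε) (fk (α X i)))

/-- The group elements inside `𝒰_X(ε)[σ]`. -/
def s (g : SGroup n) : GQσ X ε := SkewMonoidAlgebra.of (GQ X ε) (SGroup n) g

/-- The generator `E_i` in `U_X(ε)[σ]`. -/
def E (i : ℕ) : YQσ X ε := SkewMonoidAlgebra.single 1 (Pres.mk (YQRel X ε) (fe i))

/-- The generator `F_i` in `U_X(ε)[σ]`. -/
def F (i : ℕ) : YQσ X ε := SkewMonoidAlgebra.single 1 (Pres.mk (YQRel X ε) (ff i))

/-- The element `K_i = K_{α_i}` in `U_X(ε)[σ]`. -/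
def K (i : ℕ) : YQσ X ε :=
  SkewMonoidAlgebra.single 1 (Pres.mk (YQRel X ε) (fk (α X i)))

/-- The group elements inside `U_X(ε)[σ]`. -/
def S (g : SGroup n) : YQσ X ε := SkewMonoidAlgebra.of (YQ X ε) (SGroup n) g

/-- The subalgebra `𝒳` of `U_X(ε)[σ]` generated by `E_i, F_i, K_i` (`i ∈ I`) and `σ_j` (`j ∈ 𝕀`). -/
def scrX : Subalgebra Kq (YQσ X ε) :=
  Algebra.adjoin Kq
    ({x | ∃ i < n, x = E X ε i ∨ x = F X ε i ∨ x = K X ε i} ∪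
      {x | ∃ j : Idx n, x = S X ε (sg j)})

/-- The subalgebra `𝒴` of `𝒰_X(ε)[σ]` generated by `e_i, f_i, k_i` (`i ∈ I`) and `σ_j` (`j ∈ 𝕀`). -/
def scrY : Subalgebra Kq (GQσ X ε) :=
  Algebra.adjoin Kq
    ({x | ∃ i < n, x = e X ε i ∨ x = f X ε i ∨ x = k X ε i} ∪
      {x | ∃ j : Idx n, x = s X ε (sg j)})

/-- `E_i` as an element of `𝒳`. -/
def XE (i : Fin n) : scrX X ε :=
  ⟨E X ε i, Algebra.subset_adjoin (Or.inl ⟨i, i.2, Or.inl rfl⟩)⟩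

/-- `F_i` as an element of `𝒳`. -/
def XF (i : Fin n) : scrX X ε :=
  ⟨F X ε i, Algebra.subset_adjoin (Or.inl ⟨i, i.2, Or.inr (Or.inl rfl)⟩)⟩

/-- `K_i` as an element of `𝒳`. -/
def XK (i : Fin n) : scrX X ε :=
  ⟨K X ε i, Algebra.subset_adjoin (Or.inl ⟨i, i.2, Or.inr (Or.inr rfl)⟩)⟩

/-- `σ_j` as an element of `𝒳`. -/
def Xσ (j : Idx n) : scrX X ε := ⟨S X ε (sg j), Algebra.subset_adjoin (Or.inr ⟨j, rfl⟩)⟩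

/-- `σ_j` as an element of `𝒴`. -/
def Yσ (j : Idx n) : scrY X ε := ⟨s X ε (sg j), Algebra.subset_adjoin (Or.inr ⟨j, rfl⟩)⟩

/-! The prescribed values of the map `τ`. -/

/-- `𝕀` is partitioned into the maximal intervals `𝕀⁽ᵏ⁾ = {i_{k-1} + 1, …, i_k}` on which `ε` is
constant. For `i ∈ 𝕀⁽ᵏ⁾` this is `i_{k-1}`, the predecessor of the smallest element of the
interval of `i`. -/
def blk (ε : Parity n) : ℕ → ℕ
  | 0 => 0
  | i + 1 => if i = 0 ∨ eps ε i ≠ eps ε (i + 1) then i else blk ε i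

/-- `σ_{≤ j} = σ_1 ⋯ σ_j`. -/
def sle (j : ℕ) : SGroup n := ∏ l ∈ Finset.Icc 1 j, sg l

/-- `ς_i = σ_i σ_{i+1}`. -/
def vs (i : ℕ) : SGroup n := sg i * sg (i + 1)

/-- The element assigned to `E_i` by the case `(ε_m, ε_{m+1})`, with the `σ`'s and the signs those
of the index `m`; here `m = i` unless `i = 0`. -/
def tE (i m : ℕ) : GQσ X ε :=
  if eps ε m = 0 then
    if eps ε (m + 1) = 0 then e X ε i
    else e X ε i * s X ε (sle m)
  else
    if eps ε (m + 1) = 0 then e X ε i * s X ε (sle m) * s X ε (vs m) ^ (m - blk ε m)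
    else e X ε i * s X ε (vs m) ^ (m - blk ε m)

/-- The element assigned to `F_i`, as for `E_i`. -/
def tF (i m : ℕ) : GQσ X ε :=
  if eps ε m = 0 then
    if eps ε (m + 1) = 0 then f X ε i
    else f X ε i * s X ε (sle m) * s X ε (vs m)
  else
    if eps ε (m + 1) = 0 then
      (-1) ^ (m - blk ε m) * (f X ε i * s X ε (sle m) * s X ε (vs m) ^ (m - blk ε m - 1))
    else -(f X ε i * s X ε (vs m) ^ (m - blk ε m - 1))

/-- The element assigned to `K_i`, as for `E_i`. -/
def tK (i m : ℕ) : GQσ X ε :=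
  if eps ε m = 0 ∧ eps ε (m + 1) = 0 then k X ε i else k X ε i * s X ε (vs m)

/-- The prescribed value `τ(E_i)`. -/
def tauE (i : ℕ) : GQσ X ε :=
  if i = 0 then
    match X with
    | DType.D => tE DType.D ε 0 1
    | DType.C => (-1) ^ eps ε 1 * e DType.C ε 0
  else tE X ε i i

/-- The prescribed value `τ(F_i)`. -/
def tauF (i : ℕ) : GQσ X ε :=
  if i = 0 then
    match X with
    | DType.D => tF DType.D ε 0 1
    | DType.C => f DType.C ε 0
  else tF X ε i i

/-- The prescribed value `τ(K_i)`. -/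
def tauK (i : ℕ) : GQσ X ε :=
  if i = 0 then
    match X with
    | DType.D => tK DType.D ε 0 1
    | DType.C => k DType.C ε 0
  else tK X ε i i

end QOsp

end

noncomputable section

namespace QOsp

variable {n : ℕ}

/-! The map `τ` multiplies each generator by a scalar and by an element of the sign group, so it is
a twist by signs. Suppose `u` is an eigenvector for a character of the sign group under conjugation,
and `v = c u g`. Multiplying two such `v`'s gives the product of the `u`'s, up to a scalar and a
group element on the right. Swapping the two factors changes the scalar by a sign, the symmetrized
pairing `pr` of the two weights. A bracket of the `v`'s with parameter `t'` is therefore an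
invertible multiple of the bracket of the `u`'s with parameter `t' * pr` (`Tw.br`), and one vanishes
iff the other does (`Tw.eq_zero_iff`).

Every Serre-type relator on either side is a square, an iterated bracket, or a scalar multiple of a
difference of two iterated brackets of equal weight; in the quartic cases this uses other relators.
So the comparison reduces to signs, and these all follow from `chi_gE_mul`: the pairing of the
weights of `E_i` and `E_j` is `(-1)^{p(i)p(j)} χ_j(gK_i)`. The first factor turns commutators into
supercommutators, and the second is the sign by which `𝐪(α_i, α_j)` differs from `q^{(α_i|α_j)}`.
For `F` the pairing is the same. Between `E_i` and `F_j` only the first factor survives, as a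
supercommutator requires.

To twist all `k_μ`, and not only the `k_i`, the assignment `α_i ↦ gK_i` is extended to a
homomorphism `piK` from the weight lattice with `𝐪(μ, α_i) = χ_i(piK μ) q^{(μ|α_i)}` (`piK_α`,
`bq_eq`). The two presentations then become equivalent for any pair of twisted homomorphisms from
the free algebra (`Twisted.relations_iff`). Used in one direction this gives `τ` on the entire
semidirect products, and in the other direction its inverse. The isomorphism of the full semidirect
products carries generators of `𝒳` into `𝒴`, and its inverse carries generators of `𝒴` into `𝒳`, so
it restricts to the subalgebras. -/

/-- A sign as a scalar of the ground field. -/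
def sgn : ℤˣ →* Kq := (Int.castRingHom Kq).toMonoidHom.comp (Units.coeHom ℤ)

theorem sgn_def (u : ℤˣ) : sgn u = ((u : ℤ) : Kq) := rfl

@[simp] theorem sgn_neg_one : sgn (-1) = -1 := by simp [sgn_def]

@[simp] theorem sgn_mul_self (u : ℤˣ) : sgn u * sgn u = 1 := unit_sq u

theorem sgn_ne_zero (u : ℤˣ) : sgn u ≠ 0 := fun h => by simpa [h] using sgn_mul_self u

/-! ### Weights, their sign pairing, and twisted elements. -/

/-- A weight: a character of the sign group together with an element of the group. -/
abbrev Weight (n : ℕ) : Type := (SGroup n →* ℤˣ) × SGroup n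

/-- The symmetrized pairing of two weights. -/
def pr (a b : Weight n) : ℤˣ := b.1 a.2 * a.1 b.2

theorem pr_mul_left (a b c : Weight n) : pr (a * b) c = pr a c * pr b c := by
  simp only [pr, Prod.fst_mul, Prod.snd_mul, map_mul, MonoidHom.mul_apply]
  exact mul_mul_mul_comm _ _ _ _

theorem pr_mul_right (a b c : Weight n) : pr a (b * c) = pr a b * pr a c := by
  simp only [pr, Prod.fst_mul, Prod.snd_mul, map_mul, MonoidHom.mul_apply]
  exact mul_mul_mul_comm _ _ _ _

theorem pr_comm (a b : Weight n) : pr a b = pr b a := mul_comm _ _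

/-- The same sign occurs twice. Hence a repeated letter in an iterated bracket contributes no sign
with itself, whatever its parity. -/
theorem pr_self (a : Weight n) : pr a a = 1 := Int.units_mul_self _

section Twist

variable {B : Type} [Ring B] [Algebra Kq B]

/-- `u` is homogeneous for the character `a.1`, and `v` is `c` times `u` times the group element
`a.2`. -/
structure Tw (s : SGroup n →* B) (a : Weight n) (c : Kq) (u v : B) : Prop where
  comm : ∀ h, s h * u = sgn (a.1 h) • (u * s h)
  eq : v = c • (u * s a.2)

variable {s : SGroup n →* B} {a a' : Weight n} {c c' : Kq} {u v u' v' : B}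

/-- The only cost of collecting the group elements on the right is moving `s a.2` past `u'`, which
produces the sign `a'.1 a.2`. -/
theorem Tw.mul (h : Tw s a c u v) (h' : Tw s a' c' u' v') :
    Tw s (a * a') (c * c' * sgn (a'.1 a.2)) (u * u') (v * v') where
  comm g := by
    rw [← mul_assoc, h.comm, smul_mul_assoc, mul_assoc, h'.comm, mul_smul_comm, smul_smul,
      mul_assoc]
    simp
  eq := by
    rw [h.eq, h'.eq, smul_mul_smul_comm, mul_assoc u, ← mul_assoc (s a.2), h'.comm,
      smul_mul_assoc, mul_smul_comm, smul_smul, Prod.snd_mul, map_mul]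
    simp only [mul_assoc]

theorem Tw.smul (h : Tw s a c u v) (t : Kq) : Tw s a c (t • u) (t • v) where
  comm g := by rw [mul_smul_comm, h.comm, smul_mul_assoc, smul_comm]
  eq := by rw [h.eq, smul_mul_assoc, smul_comm]

theorem Tw.sub (h : Tw s a c u v) (h' : Tw s a c u' v') : Tw s a c (u - u') (v - v') where
  comm g := by rw [mul_sub, h.comm, h'.comm, sub_mul, smul_sub]
  eq := by rw [h.eq, h'.eq, sub_mul, smul_sub]

/-- Since the sign group is commutative, `v * v'` and `v' * v` carry the same group element. Their
scalars are `c * c'` times `a'.1 a.2` and `a.1 a'.2` respectively, and the ratio of these signs is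
`pr a a'`. The parameter of the bracket absorbs exactly this ratio. -/
theorem Tw.br (h : Tw s a c u v) (h' : Tw s a' c' u' v') (t t' : Kq)
    (ht : t = t' * sgn (pr a a')) :
    Tw s (a * a') (c * c' * sgn (a'.1 a.2)) (br u u' t) (br v v' t') := by
  refine (h.mul h').sub ?_
  have h2 := ((h'.mul h).smul t')
  rw [mul_comm a' a] at h2
  refine ⟨fun g => ?_, ?_⟩
  · rw [mul_smul_comm, (h'.mul h).comm, smul_mul_assoc, smul_comm, mul_comm a' a]
  · rw [h2.eq, smul_mul_assoc, smul_mul_assoc, smul_smul, smul_smul, ht, pr, map_mul]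
    congr 1
    linear_combination (-c * c' * t' * sgn (a.1 a'.2)) * sgn_mul_self (a'.1 a.2)

/-- Both the scalar `c` and the group element `s a.2` are invertible. -/
theorem Tw.eq_zero_iff (h : Tw s a c u v) (hc : c ≠ 0) : u = 0 ↔ v = 0 := by
  constructor
  · rintro rfl
    simpa using h.eq
  · intro hv
    have h1 := h.eq
    rw [hv, eq_comm, smul_eq_zero_iff_right hc] at h1
    calc u = u * s a.2 * s (a.2⁻¹) := by rw [mul_assoc, ← map_mul]; simp
      _ = 0 := by rw [h1, zero_mul]

/-- Homogeneity of the twisting element, from the side of the twisted element. -/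
theorem Tw.symm (h : ∀ g, s g * v = sgn (a.1 g) • (v * s g)) (hc : c ≠ 0) :
    Tw s a c (c⁻¹ • (v * s a.2⁻¹)) v where
  comm g := by
    rw [mul_smul_comm, ← mul_assoc, h, smul_mul_assoc, smul_mul_assoc, mul_assoc, mul_assoc,
      ← map_mul, ← map_mul, mul_comm g, smul_comm]
  eq := by
    rw [smul_mul_assoc, mul_assoc, ← map_mul, smul_smul, mul_inv_cancel₀ hc]
    simp

/-! ### Serre relators as iterated brackets. -/

/-- The parameters are the roots of `T² - tT + 1`. In bracket form a Serre relator can be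
transferred by `Tw.br`, one bracket at a time. -/
theorem serre_eq_br (x y : B) {a b t : Kq} (ht : t = a + b) (hab : a * b = 1) :
    x * x * y - t • (x * y * x) + y * x * x = br x (br x y a) b := by
  subst ht
  simp only [QOsp.br, mul_sub, sub_mul, smul_sub, mul_smul_comm, smul_mul_assoc, smul_smul,
    mul_assoc, mul_comm b a, hab]
  module

/-- Expanding the triple bracket gives eight words. The two containing `u * u` die, and `v * w = w *
v` merges `u v w u` and `u w v u`, whose coefficients then add up to `σ (q + q⁻¹)`. The identity
thus holds only modulo the quadratic relations. -/
theorem quartic_eq_br (u v w : B) {σ t : Kq} (ht : t = q + q⁻¹) (hσ : σ * σ = 1)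
    (hq : q ≠ 0) (hu : u * u = 0) (hvw : v * w = w * v) :
    u * v * u * w - u * w * u * v + (σ * t) • (u * v * w * u) - v * u * w * u + w * u * v * u =
      br u (br (br v u (σ * q)) w (-σ * q⁻¹)) 1 := by
  subst ht
  have h1 : u * (u * (v * w)) = 0 := by rw [← mul_assoc, hu, zero_mul]
  have h2 : w * (v * (u * u)) = 0 := by rw [hu, mul_zero, mul_zero]
  have h4 : u * (w * (v * u)) = u * (v * (w * u)) := by rw [← mul_assoc w, ← hvw, mul_assoc]
  have h5 : -σ * q⁻¹ * (σ * q) = -1 := by field_simp; linear_combination -hσ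
  simp only [QOsp.br, mul_sub, sub_mul, smul_sub, mul_smul_comm, smul_mul_assoc, smul_smul,
    mul_assoc, h1, h2, h4, smul_zero, one_smul, h5]
  module

end Twist

/-! ### The bilinear form and the parity of the simple roots -/

theorem eps_zero_or_one (ε : Parity n) (j : ℕ) : eps ε j = 0 ∨ eps ε j = 1 := by
  unfold eps
  split_ifs with h
  · omega
  · exact Or.inl rfl

theorem form_comm (ε : Parity n) (μ ν : Wt n) : form ε μ ν = form ε ν μ :=
  Finset.sum_congr rfl fun _ _ => by ring

theorem form_sub_right (ε : Parity n) (μ ν ν' : Wt n) :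
    form ε μ (ν - ν') = form ε μ ν - form ε μ ν' := by
  simp only [form, ← Finset.sum_sub_distrib]
  exact Finset.sum_congr rfl fun _ _ => by simp only [Pi.sub_apply]; ring

theorem form_neg_right (ε : Parity n) (μ ν : Wt n) : form ε μ (-ν) = -form ε μ ν := by
  simp only [form, ← Finset.sum_neg_distrib]
  exact Finset.sum_congr rfl fun _ _ => by simp only [Pi.neg_apply]; ring

theorem form_two_smul_right (ε : Parity n) (μ ν : Wt n) :
    form ε μ (2 • ν) = 2 * form ε μ ν := by
  simp only [form, Finset.mul_sum]
  exact Finset.sum_congr rfl fun _ _ => by simp only [Pi.smul_apply]; ring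

theorem form_δ_left (ε : Parity n) {j : ℕ} (hj : j ∈ Finset.Icc 1 n) (ν : Wt n) :
    form ε (δ j) ν = (-1) ^ eps ε j * ν ⟨j, hj⟩ := by
  unfold form
  rw [Finset.sum_eq_single ⟨j, hj⟩]
  · simp [δ]
  · intro l _ hl
    have : (l : ℕ) ≠ j := fun h => hl (Subtype.ext h)
    simp [δ, this]
  · simp

theorem form_δ_δ (ε : Parity n) {i j : ℕ} (hi : 1 ≤ i) (hi' : i ≤ n) :
    form ε (δ i) (δ j) = if i = j then (-1) ^ eps ε i else 0 := by
  rw [form_δ_left ε (Finset.mem_Icc.2 ⟨hi, hi'⟩)]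
  simp [δ]

theorem α_of_pos (X : DType) {i : ℕ} (hi : 1 ≤ i) : (α X i : Wt n) = δ i - δ (i + 1) :=
  if_neg (by omega)

theorem α_D_zero : (α DType.D 0 : Wt n) = -δ 1 - δ 2 := rfl

theorem α_C_zero : (α DType.C 0 : Wt n) = -(2 • δ 1) := rfl

theorem form_δ_α (X : DType) (ε : Parity n) {i j : ℕ} (hj : 1 ≤ j) (hj' : j ≤ n) (hi : 1 ≤ i) :
    form ε (δ j) (α X i) =
      if j = i then (-1) ^ eps ε j else if j = i + 1 then -(-1) ^ eps ε j else 0 := by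
  rw [α_of_pos X hi, form_sub_right, form_δ_δ ε hj hj', form_δ_δ ε hj hj']
  split_ifs <;> omega

theorem form_δ_α_D_zero (ε : Parity n) {j : ℕ} (hj : 1 ≤ j) (hj' : j ≤ n) :
    form ε (δ j) (α DType.D 0) = if j = 1 ∨ j = 2 then -(-1) ^ eps ε j else 0 := by
  rw [α_D_zero, form_sub_right, form_neg_right, form_δ_δ ε hj hj', form_δ_δ ε hj hj']
  split_ifs <;> omega

theorem form_δ_α_C_zero (ε : Parity n) {j : ℕ} (hj : 1 ≤ j) (hj' : j ≤ n) :
    form ε (δ j) (α DType.C 0) = if j = 1 then -(2 * (-1) ^ eps ε j) else 0 := by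
  rw [α_C_zero, form_neg_right, form_two_smul_right, form_δ_δ ε hj hj']
  split_ifs <;> simp

theorem form_α_α (X : DType) (ε : Parity n) {i j : ℕ} (hi : 1 ≤ i) :
    form ε (α X i) (α X j) = form ε (δ i) (α X j) - form ε (δ (i + 1)) (α X j) := by
  rw [form_comm, α_of_pos X hi, form_sub_right, form_comm, form_comm ε _ (δ (i + 1))]

theorem form_α_D_zero (ε : Parity n) (ν : Wt n) :
    form ε (α DType.D 0) ν = -form ε (δ 1) ν - form ε (δ 2) ν := by
  rw [form_comm, α_D_zero, form_sub_right, form_neg_right, form_comm, form_comm ε _ (δ 2)]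

theorem form_α_C_zero (ε : Parity n) (ν : Wt n) :
    form ε (α DType.C 0) ν = -(2 * form ε (δ 1) ν) := by
  rw [form_comm, α_C_zero, form_neg_right, form_two_smul_right, form_comm]

theorem form_α_self_eq_zero_iff (X : DType) (ε : Parity n) {i : ℕ} (hi : 1 ≤ i) (hi' : i < n) :
    form ε (α X i) (α X i) = 0 ↔ eps ε i ≠ eps ε (i + 1) := by
  rw [form_α_α X ε hi, form_δ_α X ε hi hi'.le hi, form_δ_α X ε (by omega) hi' hi]
  rcases eps_zero_or_one ε i with h | h <;> rcases eps_zero_or_one ε (i + 1) with h' | h' <;>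
    simp [h, h']

theorem form_α_D_zero_self_eq_zero_iff (ε : Parity n) (hn : 2 ≤ n) :
    form ε (α DType.D 0) (α DType.D 0) = 0 ↔ eps ε 1 ≠ eps ε 2 := by
  rw [form_α_D_zero, form_δ_α_D_zero ε (j := 1) le_rfl (by omega),
    form_δ_α_D_zero ε (j := 2) (by omega) hn]
  rcases eps_zero_or_one ε 1 with h | h <;> rcases eps_zero_or_one ε 2 with h' | h' <;>
    simp [h, h']

theorem p_of_pos (X : DType) (ε : Parity n) {i : ℕ} (hi : 1 ≤ i) (hi' : i < n) :
    p X ε i = if eps ε i = eps ε (i + 1) then 0 else 1 := by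
  unfold p
  simp only [form_α_self_eq_zero_iff X ε hi hi']
  split_ifs <;> simp_all

theorem p_D_zero (ε : Parity n) (hn : 2 ≤ n) : p DType.D ε 0 = p DType.D ε 1 := by
  rw [p_of_pos DType.D ε (i := 1) le_rfl hn, p]
  simp only [form_α_D_zero_self_eq_zero_iff ε hn]
  split_ifs <;> simp_all

theorem p_C_zero (ε : Parity n) (hn : 1 ≤ n) : p DType.C ε 0 = 0 := by
  rw [p, form_α_C_zero, form_δ_α_C_zero ε le_rfl hn]
  simp

theorem form_α_α_of_far (X : DType) (ε : Parity n) {i j : ℕ} (hi : 1 ≤ i) (hij : i + 2 ≤ j)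
    (hj : j < n) : form ε (α X i) (α X j) = 0 := by
  rw [form_α_α X ε hi, form_δ_α X ε hi (by omega) (by omega),
    form_δ_α X ε (by omega) (by omega) (by omega)]
  simp [show i ≠ j by omega, show i ≠ j + 1 by omega, show i + 1 ≠ j by omega]

theorem form_α_α_of_adj (X : DType) (ε : Parity n) {i : ℕ} (hi : 1 ≤ i) (hj : i + 1 < n) :
    form ε (α X i) (α X (i + 1)) ≠ 0 := by
  rw [form_α_α X ε hi, form_δ_α X ε hi (by omega) (by omega),
    form_δ_α X ε (by omega) (by omega) (by omega)]
  simp [show i ≠ i + 1 + 1 by omega]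

theorem form_α_D_zero_one (ε : Parity n) (hn : 2 ≤ n)
    (h : form ε (α DType.D 0) (α DType.D 1) = 0) : eps ε 1 = eps ε 2 := by
  rw [form_α_D_zero, form_δ_α _ ε le_rfl (by omega) le_rfl,
    form_δ_α _ ε (by omega) hn le_rfl] at h
  revert h
  rcases eps_zero_or_one ε 1 with h | h <;> rcases eps_zero_or_one ε 2 with h' | h' <;>
    simp [h, h']

theorem form_α_D_zero_two (ε : Parity n) (hn : 2 ≤ n) :
    form ε (α DType.D 0) (α DType.D 2) ≠ 0 := by
  rw [form_α_D_zero, form_δ_α _ ε le_rfl (by omega) (by omega),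
    form_δ_α _ ε (by omega) hn (by omega)]
  simp

theorem form_α_D_zero_of_far (ε : Parity n) {j : ℕ} (hn : 2 ≤ n) (hj : 3 ≤ j) :
    form ε (α DType.D 0) (α DType.D j) = 0 := by
  rw [form_α_D_zero, form_δ_α _ ε le_rfl (by omega) (by omega),
    form_δ_α _ ε (by omega) hn (by omega)]
  simp [show 1 ≠ j by omega, show 2 ≠ j by omega]
  omega

/-! ### The sign characters -/

/-- The sign `(-1)^{ε_j}`. -/
def us (ε : Parity n) (j : ℕ) : ℤˣ := (-1) ^ eps ε j

theorem us_mul_self (ε : Parity n) (j : ℕ) : us ε j * us ε j = 1 := Int.units_mul_self _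

theorem SGroup.mul_self (g : SGroup n) : g * g = 1 := by
  funext l; exact Int.units_mul_self _

theorem SGroup.inv_eq (g : SGroup n) : g⁻¹ = g := inv_eq_of_mul_eq_one_left (SGroup.mul_self g)

theorem sg_eq_one {j : ℕ} (hj : j ∉ Finset.Icc 1 n) : (sg j : SGroup n) = 1 := by
  funext l
  have : (l : ℕ) ≠ j := fun h => hj (h ▸ l.2)
  simp [sg, this]

theorem eps_eq_zero (ε : Parity n) {j : ℕ} (hj : j ∉ Finset.Icc 1 n) : eps ε j = 0 := dif_neg hj

theorem chi_sg_nat (X : DType) (ε : Parity n) (i : ℕ) {j : ℕ} (hj : j ∈ Finset.Icc 1 n) :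
    chi X ε i (sg j) = (-1) ^ ((eps ε j : ℤ) * form ε (δ j) (α X i)) := chi_sg X ε i ⟨j, hj⟩

theorem chi_sg_of_eps (X : DType) (ε : Parity n) (i : ℕ) {j : ℕ} (hj : eps ε j = 0) :
    chi X ε i (sg j) = 1 := by
  by_cases h : j ∈ Finset.Icc 1 n
  · rw [chi_sg_nat X ε i h, hj]; simp
  · rw [sg_eq_one h, map_one]

/-- For `j` outside `1, …, n` the formula is still correct, because then `sg j = 1` and `eps ε j =
0`. -/
theorem chi_sg_of_pos (X : DType) (ε : Parity n) {i : ℕ} (hi : 1 ≤ i) (j : ℕ) :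
    chi X ε i (sg j) = if j = i ∨ j = i + 1 then us ε j else 1 := by
  unfold us
  rcases eps_zero_or_one ε j with h0 | h1
  · rw [chi_sg_of_eps X ε i h0, h0]; simp
  · have hj : j ∈ Finset.Icc 1 n := by
      by_contra h
      simp [eps_eq_zero ε h] at h1
    rw [chi_sg_nat X ε i hj, form_δ_α X ε (Finset.mem_Icc.1 hj).1 (Finset.mem_Icc.1 hj).2 hi, h1]
    split_ifs <;> first | omega | simp

/-- The roots `-δ_1 - δ_2` and `δ_1 - δ_2` agree modulo 2, and signs see only coefficients modulo 2.
This is why the zeroth node of type `D` can be treated as a copy of the first. -/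
theorem chi_D_zero (ε : Parity n) : chi DType.D ε 0 = chi DType.D ε 1 := by
  refine MonoidHom.ext fun g => ?_
  change ∏ j : Idx n, g j ^ _ = ∏ j : Idx n, g j ^ _
  refine Finset.prod_congr rfl fun j _ => ?_
  have hj := Finset.mem_Icc.1 j.2
  rw [form_δ_α_D_zero ε hj.1 hj.2, form_δ_α DType.D ε hj.1 hj.2 le_rfl]
  rcases Int.units_eq_one_or (g j) with h | h
  · simp [h]
  · rw [h]
    rcases eps_zero_or_one ε j with h' | h' <;> rw [h'] <;> split_ifs <;>
      first | omega | simp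

/-- The coefficient of `-2δ_1` is even, so no sign can appear: in type `C` the zeroth node is
invisible to the twist. -/
theorem chi_C_zero (ε : Parity n) : chi DType.C ε 0 = 1 := by
  refine MonoidHom.ext fun g => ?_
  change ∏ j : Idx n, g j ^ _ = 1
  refine Finset.prod_eq_one fun j _ => ?_
  have hj := Finset.mem_Icc.1 j.2
  rw [form_δ_α_C_zero ε hj.1 hj.2]
  rcases Int.units_eq_one_or (g j) with h | h
  · simp [h]
  · rw [h]
    rcases eps_zero_or_one ε j with h' | h' <;> rw [h'] <;> split_ifs <;> simp

theorem chi_vs (X : DType) (ε : Parity n) (i m : ℕ) :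
    chi X ε i (vs m) = chi X ε i (sg m) * chi X ε i (sg (m + 1)) := map_mul _ _ _

theorem chi_vs_self (X : DType) (ε : Parity n) {i : ℕ} (hi : 1 ≤ i) :
    chi X ε i (vs i) = us ε i * us ε (i + 1) := by
  simp [chi_vs, chi_sg_of_pos X ε hi]

theorem chi_vs_pred (X : DType) (ε : Parity n) {i : ℕ} (hi : 1 ≤ i) :
    chi X ε (i + 1) (vs i) = us ε (i + 1) := by
  simp [chi_vs, chi_sg_of_pos X ε (show 1 ≤ i + 1 by omega), show i ≠ i + 1 + 1 by omega]

theorem chi_vs_succ (X : DType) (ε : Parity n) {i : ℕ} (hi : 1 ≤ i) :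
    chi X ε i (vs (i + 1)) = us ε (i + 1) := by
  simp [chi_vs, chi_sg_of_pos X ε hi, show i + 1 + 1 ≠ i by omega]

theorem chi_vs_of_far (X : DType) (ε : Parity n) {i m : ℕ} (hi : 1 ≤ i)
    (h : i + 2 ≤ m ∨ m + 2 ≤ i) : chi X ε i (vs m) = 1 := by
  rw [chi_vs, chi_sg_of_pos X ε hi, chi_sg_of_pos X ε hi, if_neg (by omega), if_neg (by omega),
    one_mul]

theorem sle_succ (m : ℕ) : (sle (m + 1) : SGroup n) = sle m * sg (m + 1) :=
  Finset.prod_Icc_succ_top (by omega) _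

/-- The element `σ_{≤ m}` meets neither of the indices `i`, `i + 1` of `α_i` if `m < i`, only the
first if `m = i`, and both if `m > i`. This asymmetry is what lets `σ_{≤ m}` produce the super sign
between distant odd nodes. -/
theorem chi_sle_of_lt (X : DType) (ε : Parity n) {i m : ℕ} (h : m < i) :
    chi X ε i (sle m) = 1 := by
  rw [sle, map_prod]
  refine Finset.prod_eq_one fun l hl => ?_
  rw [Finset.mem_Icc] at hl
  rw [chi_sg_of_pos X ε (by omega), if_neg (by omega)]

theorem chi_sle_self (X : DType) (ε : Parity n) {i : ℕ} (hi : 1 ≤ i) :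
    chi X ε i (sle i) = us ε i := by
  obtain ⟨m, rfl⟩ : ∃ m, i = m + 1 := ⟨i - 1, by omega⟩
  rw [sle_succ, map_mul, chi_sle_of_lt X ε (by omega), chi_sg_of_pos X ε hi]
  simp

theorem chi_sle_of_gt (X : DType) (ε : Parity n) {i m : ℕ} (hi : 1 ≤ i) (h : i < m) :
    chi X ε i (sle m) = us ε i * us ε (i + 1) := by
  induction m, h using Nat.le_induction with
  | base => rw [sle_succ, map_mul, chi_sle_self X ε hi, chi_sg_of_pos X ε hi]; simp
  | succ m hm ih =>
    rw [sle_succ, map_mul, ih, chi_sg_of_pos X ε hi, if_neg (by omega), mul_one]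

/-! ### The group elements in the definition of `τ` -/

/-- The group element in `τ(K_m)` for `1 ≤ m`. -/
def kPart (ε : Parity n) (m : ℕ) : SGroup n :=
  if eps ε m = 0 ∧ eps ε (m + 1) = 0 then 1 else vs m

/-- The group element in `τ(E_m)` for `1 ≤ m`. -/
def ePart (ε : Parity n) (m : ℕ) : SGroup n :=
  (if eps ε m = eps ε (m + 1) then 1 else sle m) *
    (if eps ε m = 0 then 1 else vs m ^ (m - blk ε m))

/-- The group element in `τ(K_i)`. -/
def gK (X : DType) (ε : Parity n) (i : ℕ) : SGroup n :=
  if i = 0 then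
    match X with
    | DType.D => kPart ε 1
    | DType.C => 1
  else kPart ε i

/-- The group element in `τ(E_i)`. -/
def gE (X : DType) (ε : Parity n) (i : ℕ) : SGroup n :=
  if i = 0 then
    match X with
    | DType.D => ePart ε 1
    | DType.C => 1
  else ePart ε i

theorem gK_of_pos (X : DType) (ε : Parity n) {i : ℕ} (hi : 1 ≤ i) : gK X ε i = kPart ε i :=
  if_neg (by omega)

theorem gE_of_pos (X : DType) (ε : Parity n) {i : ℕ} (hi : 1 ≤ i) : gE X ε i = ePart ε i :=
  if_neg (by omega)

theorem gK_D_zero (ε : Parity n) : gK DType.D ε 0 = gK DType.D ε 1 := rfl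

theorem gE_D_zero (ε : Parity n) : gE DType.D ε 0 = gE DType.D ε 1 := rfl

theorem gK_C_zero (ε : Parity n) : gK DType.C ε 0 = 1 := rfl

theorem gE_C_zero (ε : Parity n) : gE DType.C ε 0 = 1 := rfl

/-- Where `kPart` drops `ς_m`, both parities are zero and `ς_m` acts trivially anyway. -/
theorem chi_kPart (X : DType) (ε : Parity n) (i m : ℕ) :
    chi X ε i (kPart ε m) = chi X ε i (vs m) := by
  unfold kPart
  split_ifs with h
  · rw [map_one, chi_vs, chi_sg_of_eps X ε i h.1, chi_sg_of_eps X ε i h.2, one_mul]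
  · rfl

theorem blk_lt (ε : Parity n) {m : ℕ} (hm : 1 ≤ m) : blk ε m < m := by
  induction m, hm using Nat.le_induction with
  | base => simp [blk]
  | succ m hm ih => rw [blk]; split_ifs <;> omega

theorem blk_succ_of_ne (ε : Parity n) {m : ℕ} (h : eps ε m ≠ eps ε (m + 1)) :
    blk ε (m + 1) = m := by
  rw [blk, if_pos (Or.inr h)]

theorem blk_succ_of_eq (ε : Parity n) {m : ℕ} (hm : 1 ≤ m) (h : eps ε m = eps ε (m + 1)) :
    blk ε (m + 1) = blk ε m := by
  rw [blk, if_neg (by simp [h]; omega)]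

/-- The factors `σ_{≤ m}` account for the super sign. The factor `us ε (i + 1)`, nontrivial only if
`ε_{i+1} = 1`, comes from the powers of `ς`: inside a block of ones consecutive exponents differ by
one, so exactly one sign is left over. -/
theorem chi_ePart_of_adj (X : DType) (ε : Parity n) {i : ℕ} (hi : 1 ≤ i) (hj : i + 1 < n) :
    chi X ε (i + 1) (ePart ε i) * chi X ε i (ePart ε (i + 1)) =
      (-1) ^ (p X ε i * p X ε (i + 1)) * us ε (i + 1) := by
  have hb := blk_lt ε hi
  rw [p_of_pos X ε hi (by omega), p_of_pos X ε (by omega) hj]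
  unfold ePart
  simp only [map_mul, apply_ite (chi X ε i), apply_ite (chi X ε (i + 1)), map_one, map_pow,
    chi_sle_of_lt X ε (Nat.lt_succ_self i), chi_sle_of_gt X ε hi (Nat.lt_succ_self i),
    chi_vs_pred X ε hi, chi_vs_succ X ε hi, us]
  rcases eps_zero_or_one ε i with h0 | h0 <;> rcases eps_zero_or_one ε (i + 1) with h1 | h1
  · simp [h0, h1]
  -- A block of ones starts at `i + 1`, so the exponent of `ς_{i+1}` is one.
  · rw [blk_succ_of_ne ε (by omega)]
    rcases eps_zero_or_one ε (i + 1 + 1) with h2 | h2 <;> simp [h0, h1, h2]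
  · simp [h0, h1]
  -- Both indices lie in the same block of ones, so the exponent of `ς` grows by one from `i` to `i
  -- + 1`.
  · rw [blk_succ_of_eq ε hi (by omega), show i + 1 - blk ε i = i - blk ε i + 1 by omega]
    rcases eps_zero_or_one ε (i + 1 + 1) with h2 | h2 <;> simp [h0, h1, h2, pow_succ]

/-- The `ς` factors are too far away to act. If `j` is odd, `σ_{≤ j}` acts on `e_i` by
`(-1)^{p(i)}`, while `σ_{≤ i}` does not see `e_j`. -/
theorem chi_ePart_of_far (X : DType) (ε : Parity n) {i j : ℕ} (hi : 1 ≤ i) (hij : i + 2 ≤ j)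
    (hj : j < n) :
    chi X ε j (ePart ε i) * chi X ε i (ePart ε j) = (-1) ^ (p X ε i * p X ε j) := by
  rw [p_of_pos X ε hi (by omega), p_of_pos X ε (by omega) hj]
  unfold ePart
  simp only [map_mul, apply_ite (chi X ε i), apply_ite (chi X ε j), map_one, map_pow,
    chi_sle_of_lt X ε (show i < j by omega), chi_sle_of_gt X ε hi (show i < j by omega),
    chi_vs_of_far X ε hi (Or.inl hij), chi_vs_of_far X ε (show 1 ≤ j by omega) (Or.inr hij),
    one_pow, us]
  rcases eps_zero_or_one ε i with h0 | h0 <;> rcases eps_zero_or_one ε (i + 1) with h1 | h1 <;>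
  rcases eps_zero_or_one ε j with h2 | h2 <;> rcases eps_zero_or_one ε (j + 1) with h3 | h3 <;>
  simp [h0, h1, h2, h3]

/-- Distinct orthogonal simple roots have non-adjacent indices, and then `ς_i` acts trivially. The
one exception is the pair of nodes 0 and 1 in type `D`: orthogonality there forces `ε_1 = ε_2`, and
`ς_1` acts by `(-1)^{ε_1 + ε_2} = 1`. -/
theorem chi_gK_eq_one (X : DType) (ε : Parity n) {i j : ℕ} (hn : 2 ≤ n) (hi : i < n) (hj : j < n)
    (hij : i ≠ j) (h : form ε (α X i) (α X j) = 0) : chi X ε j (gK X ε i) = 1 := by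
  have pos : ∀ i j, i < n → j < n → i ≠ j → 1 ≤ i → 1 ≤ j → form ε (α X i) (α X j) = 0 →
      chi X ε j (gK X ε i) = 1 := by
    intro i j hi hj hij hi0 hj0 h
    rw [gK_of_pos X ε hi0, chi_kPart]
    have h1 : j ≠ i + 1 := by
      rintro rfl; exact form_α_α_of_adj X ε hi0 hj h
    have h2 : i ≠ j + 1 := by
      rintro rfl; exact form_α_α_of_adj X ε hj0 hi (by rwa [form_comm])
    exact chi_vs_of_far X ε hj0 (by omega)
  cases X with
  | C =>
    rcases Nat.eq_zero_or_pos i with rfl | hi0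
    · rw [gK_C_zero, map_one]
    rcases Nat.eq_zero_or_pos j with rfl | hj0
    · rw [chi_C_zero, MonoidHom.one_apply]
    exact pos i j hi hj hij hi0 hj0 h
  | D =>
    have h01 : form ε (α DType.D 0) (α DType.D 1) = 0 → us ε 1 * us ε 2 = 1 := fun h => by
      rw [us, us, form_α_D_zero_one ε hn h]; exact Int.units_mul_self _
    rcases Nat.eq_zero_or_pos i with rfl | hi0
    · rw [gK_D_zero, gK_of_pos _ ε le_rfl, chi_kPart]
      have h2 : j ≠ 2 := by
        rintro rfl; exact form_α_D_zero_two ε hn h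
      rcases Nat.lt_or_ge j 2 with hj2 | hj2
      · obtain rfl : j = 1 := by omega
        rw [chi_vs_self _ ε le_rfl, h01 h]
      · exact chi_vs_of_far _ ε (by omega) (by omega)
    rcases Nat.eq_zero_or_pos j with rfl | hj0
    · rw [chi_D_zero, gK_of_pos _ ε hi0, chi_kPart]
      rw [form_comm] at h
      have h2 : i ≠ 2 := by
        rintro rfl; exact form_α_D_zero_two ε hn h
      rcases Nat.lt_or_ge i 2 with hj2 | hj2
      · obtain rfl : i = 1 := by omega
        rw [chi_vs_self _ ε le_rfl, h01 h]
      · exact chi_vs_of_far _ ε (by omega) (by omega)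
    exact pos i j hi hj hij hi0 hj0 h

/-- For adjacent nodes both signs are that of the shared index `δ_{i+1}`. The symmetry makes the
extra factor `gK` in the group elements of the `F_i` cancel from their pairing. -/
theorem chi_gK_comm (X : DType) (ε : Parity n) (i j : ℕ) :
    chi X ε j (gK X ε i) = chi X ε i (gK X ε j) := by
  have pos : ∀ i j, 1 ≤ i → 1 ≤ j → chi X ε j (gK X ε i) = chi X ε i (gK X ε j) := by
    have lt : ∀ i j, 1 ≤ i → i < j → chi X ε j (gK X ε i) = chi X ε i (gK X ε j) := by
      intro i j hi hij
      rw [gK_of_pos X ε hi, gK_of_pos X ε (by omega), chi_kPart, chi_kPart]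
      rcases Nat.lt_or_ge j (i + 2) with h | h
      · obtain rfl : j = i + 1 := by omega
        rw [chi_vs_pred X ε hi, chi_vs_succ X ε hi]
      · rw [chi_vs_of_far X ε hi (Or.inl h), chi_vs_of_far X ε (by omega) (Or.inr h)]
    intro i j hi hj
    rcases lt_trichotomy i j with h | rfl | h
    · exact lt i j hi h
    · rfl
    · exact (lt j i hj h).symm
  cases X with
  | C =>
    rcases Nat.eq_zero_or_pos i with rfl | hi0
    · rw [gK_C_zero, map_one, chi_C_zero, MonoidHom.one_apply]
    rcases Nat.eq_zero_or_pos j with rfl | hj0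
    · rw [gK_C_zero, map_one, chi_C_zero, MonoidHom.one_apply]
    exact pos i j hi0 hj0
  | D =>
    rcases Nat.eq_zero_or_pos i with rfl | hi0 <;> rcases Nat.eq_zero_or_pos j with rfl | hj0
    · rfl
    · rw [gK_D_zero, chi_D_zero, pos 1 j le_rfl hj0]
    · rw [gK_D_zero, chi_D_zero, pos i 1 hi0 le_rfl]
    · exact pos i j hi0 hj0

theorem neg_one_pow_p (X : DType) (ε : Parity n) {i : ℕ} (hi : 1 ≤ i) (hi' : i < n) :
    (-1 : ℤˣ) ^ p X ε i = us ε i * us ε (i + 1) := by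
  rw [p_of_pos X ε hi hi', us, us]
  rcases eps_zero_or_one ε i with h0 | h0 <;> rcases eps_zero_or_one ε (i + 1) with h1 | h1 <;>
  simp [h0, h1]

theorem p_mul_self (X : DType) (ε : Parity n) (i : ℕ) : p X ε i * p X ε i = p X ε i := by
  unfold p; split_ifs <;> rfl

/-- The fundamental identity between the signs in the relations and the group elements in `τ`. -/
theorem chi_gE_mul (X : DType) (ε : Parity n) (hn : 2 ≤ n) {i j : ℕ} (hi : i < n) (hj : j < n) :
    chi X ε j (gE X ε i) * chi X ε i (gE X ε j) =
      (-1) ^ (p X ε i * p X ε j) * chi X ε j (gK X ε i) := by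
  have pos : ∀ i j, i < n → j < n → 1 ≤ i → 1 ≤ j →
      chi X ε j (gE X ε i) * chi X ε i (gE X ε j) =
        (-1) ^ (p X ε i * p X ε j) * chi X ε j (gK X ε i) := by
    have lt : ∀ i j, j < n → 1 ≤ i → i < j →
        chi X ε j (gE X ε i) * chi X ε i (gE X ε j) =
          (-1) ^ (p X ε i * p X ε j) * chi X ε j (gK X ε i) := by
      intro i j hj hi hij
      rw [gE_of_pos X ε hi, gE_of_pos X ε (by omega), gK_of_pos X ε hi, chi_kPart]
      rcases Nat.lt_or_ge j (i + 2) with h | h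
      · obtain rfl : j = i + 1 := by omega
        rw [chi_ePart_of_adj X ε hi hj, chi_vs_pred X ε hi]
      · rw [chi_ePart_of_far X ε hi h hj, chi_vs_of_far X ε (by omega) (Or.inr h), mul_one]
    intro i j hi hj hi0 hj0
    rcases lt_trichotomy i j with h | rfl | h
    · exact lt i j hj hi0 h
    -- On the diagonal the left side is a square, and on the right `(-1)^{p(i)}` cancels against the
    -- sign by which `ς_i` acts on `e_i`.
    · rw [Int.units_mul_self, p_mul_self, neg_one_pow_p X ε hi0 hi, gK_of_pos X ε hi0, chi_kPart,
        chi_vs_self X ε hi0, Int.units_mul_self]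
    · rw [mul_comm, lt j i hi hj0 h, chi_gK_comm, mul_comm (p X ε j)]
  cases X with
  | C =>
    rcases Nat.eq_zero_or_pos i with rfl | hi0
    · rw [chi_C_zero, p_C_zero ε (by omega), gE_C_zero, gK_C_zero]; simp
    rcases Nat.eq_zero_or_pos j with rfl | hj0
    · rw [chi_C_zero, p_C_zero ε (by omega), gE_C_zero]; simp
    exact pos i j hi hj hi0 hj0
  | D =>
    have h1 : 1 < n := by omega
    -- In type `D` the zeroth node has the same character, parity and group elements as the first,
    -- so every case with an index 0 is a case with index 1.
    rcases Nat.eq_zero_or_pos i with rfl | hi0 <;> rcases Nat.eq_zero_or_pos j with rfl | hj0 <;>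
      try simp only [chi_D_zero, gE_D_zero, gK_D_zero, p_D_zero ε hn]
    · exact pos 1 1 h1 h1 le_rfl le_rfl
    · exact pos 1 j h1 hj le_rfl hj0
    · exact pos i 1 hi h1 hi0 le_rfl
    · exact pos i j hi hj hi0 hj0

/-! ### Quantum integers -/

theorem qhalf_ne_zero : qhalf ≠ 0 := RatFunc.X_ne_zero

theorem q_ne_zero : q ≠ 0 := pow_ne_zero 2 qhalf_ne_zero

theorem q_sq_ne_one : q ^ 2 ≠ 1 := by
  intro h
  have h1 : (RatFunc.X : RatFunc ℂ) ^ 4 = 1 := by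
    have h2 : qhalf ^ 4 = 1 := by rw [← h, q, ← pow_mul]
    exact h2
  rw [← RatFunc.algebraMap_X, ← map_pow, ← map_one (algebraMap (Polynomial ℂ) (RatFunc ℂ))] at h1
  have h3 := congrArg Polynomial.natDegree (RatFunc.algebraMap_injective ℂ h1)
  simp at h3

theorem q_sub_inv_ne_zero : q - q⁻¹ ≠ 0 := by
  intro h
  apply q_sq_ne_one
  rw [sub_eq_zero] at h
  nth_rewrite 1 [pow_two, h]
  exact inv_mul_cancel₀ q_ne_zero

theorem qint_two : qint 2 = q + q⁻¹ := by
  have h0 := q_ne_zero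
  have h := q_sub_inv_ne_zero
  rw [qint, div_eq_iff h, ← inv_pow]
  ring

theorem qint_three : qint 3 = q ^ 2 + 1 + (q ^ 2)⁻¹ := by
  have h0 := q_ne_zero
  have h := q_sub_inv_ne_zero
  rw [qint, div_eq_iff h]
  field_simp
  ring

/-! ### Transfer of the Serre relations -/

section Transfer

variable {B : Type} [Ring B] [Algebra Kq B]

/-- Two families related by a twist which is compatible with the two sets of Serre relations. -/
structure TwFam (X : DType) (ε : Parity n) (s : SGroup n →* B) (g : ℕ → SGroup n) (c : ℕ → Kq)
    (x y : ℕ → B) : Prop where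
  tw : ∀ i < n, Tw s (chi X ε i, g i) (c i) (x i) (y i)
  ne : ∀ i, c i ≠ 0
  pr_eq : ∀ i < n, ∀ j < n, pr (chi X ε i, g i) (chi X ε j, g j) =
    (-1) ^ (p X ε i * p X ε j) * chi X ε j (gK X ε i)
  zero : X = DType.D → g 0 = g 1 ∧ c 0 = c 1

variable {X : DType} {ε : Parity n} {s : SGroup n →* B} {g : ℕ → SGroup n} {c : ℕ → Kq}
  {x y : ℕ → B}

theorem sgn_us (ε : Parity n) (i : ℕ) : sgn (us ε i) = (-1) ^ eps ε i := by
  rw [us, map_pow, sgn_neg_one]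

theorem TwFam.pr_adj (h : TwFam X ε s g c x y) {i : ℕ} (hi : 1 ≤ i) (hj : i + 1 < n) :
    pr (chi X ε i, g i) (chi X ε (i + 1), g (i + 1)) =
      (-1) ^ (p X ε i * p X ε (i + 1)) * us ε (i + 1) := by
  rw [h.pr_eq i (by omega) _ hj, gK_of_pos X ε hi, chi_kPart, chi_vs_pred X ε hi]

theorem TwFam.pr_adj' (h : TwFam X ε s g c x y) {i : ℕ} (hi : 1 ≤ i) (hj : i + 1 < n) :
    pr (chi X ε (i + 1), g (i + 1)) (chi X ε i, g i) =
      (-1) ^ (p X ε i * p X ε (i + 1)) * us ε (i + 1) := by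
  rw [pr_comm, h.pr_adj hi hj]

theorem TwFam.pr_of_form (h : TwFam X ε s g c x y) {i j : ℕ} (hn : 2 ≤ n) (hi : i < n)
    (hj : j < n) (hij : i ≠ j) (h0 : form ε (α X i) (α X j) = 0) :
    pr (chi X ε i, g i) (chi X ε j, g j) = (-1) ^ (p X ε i * p X ε j) := by
  rw [h.pr_eq i hi j hj, chi_gK_eq_one X ε hn hi hj hij h0, mul_one]

/-- The zeroth node is even and its character is trivial, so brackets with `x 0` keep their
parameter. -/
theorem TwFam.pr_C_zero (h : TwFam DType.C ε s g c x y) {i : ℕ} (hi : i < n) :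
    pr (chi DType.C ε i, g i) (chi DType.C ε 0, g 0) = 1 := by
  rw [h.pr_eq i hi 0 (by omega), p_C_zero ε (by omega), chi_C_zero]; simp

theorem TwFam.pr_C_zero' (h : TwFam DType.C ε s g c x y) {i : ℕ} (hi : i < n) :
    pr (chi DType.C ε 0, g 0) (chi DType.C ε i, g i) = 1 := by
  rw [pr_comm, h.pr_C_zero hi]

/-- Node 0 is given literally the weight and scalar of node 1, so the type `D` relations reuse the
pairings already computed among positive nodes. -/
theorem TwFam.tw_D_zero (h : TwFam DType.D ε s g c x y) (hn : 0 < n) :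
    Tw s (chi DType.D ε 1, g 1) (c 1) (x 0) (y 0) := by
  have h0 := h.tw 0 hn
  rwa [chi_D_zero, (h.zero rfl).1, (h.zero rfl).2] at h0

theorem TwFam.sq_iff (h : TwFam X ε s g c x y) {i : ℕ} (hi : i < n) :
    x i * x i = 0 ↔ y i * y i = 0 :=
  ((h.tw i hi).mul (h.tw i hi)).eq_zero_iff
    (mul_ne_zero (mul_ne_zero (h.ne i) (h.ne i)) (sgn_ne_zero _))

/-- The case `i = j` is excluded because the pairing of a weight with itself is `1`, whereas
`(-1)^{p(i)p(i)} = -1` at an odd node. -/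
theorem TwFam.comm_iff (h : TwFam X ε s g c x y) {i j : ℕ} (hn : 2 ≤ n) (hi : i < n)
    (hj : j < n) (hij : i ≠ j) (h0 : form ε (α X i) (α X j) = 0) :
    br (x i) (x j) 1 = 0 ↔ br (y i) (y j) ((-1) ^ (p X ε i * p X ε j)) = 0 := by
  refine ((h.tw i hi).br (h.tw j hj) _ _ ?_).eq_zero_iff
    (mul_ne_zero (mul_ne_zero (h.ne i) (h.ne j)) (sgn_ne_zero _))
  rw [h.pr_of_form hn hi hj hij h0, map_pow, sgn_neg_one, ← mul_pow]
  simp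

/-- Transfer of the `q`-Serre relation of order two. -/
theorem Tw.serre_iff {a b : Weight n} {d d' t σ : Kq} {u v u' v' : B} (hu : Tw s a d u u')
    (hv : Tw s b d' v v') (hd : d ≠ 0) (hd' : d' ≠ 0) (ht : t ≠ 0) (hσ : sgn (pr a b) = σ) :
    u * u * v - (σ * (t + t⁻¹)) • (u * v * u) + v * u * u = 0 ↔
      u' * u' * v' - (t + t⁻¹) • (u' * v' * u') + v' * u' * u' = 0 := by
  have hσ2 : σ * σ = 1 := by rw [← hσ, sgn_mul_self]
  rw [serre_eq_br u' v' (a := t) (b := t⁻¹) rfl (mul_inv_cancel₀ ht),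
    serre_eq_br u v (a := t * σ) (b := t⁻¹ * σ) (by ring)
      (by field_simp; linear_combination hσ2)]
  refine (hu.br (hu.br hv _ _ ?_) _ _ ?_).eq_zero_iff ?_
  · rw [hσ]
  · rw [pr_mul_right, pr_self, one_mul, hσ]
  · simp [hd, hd', sgn_ne_zero]

/-- Transfer of the relation of degree four at an odd node. -/
theorem Tw.quartic_iff {a b b' : Weight n} {d d₁ d₂ σ t₁ t₂ t₃ : Kq} {u v w u' v' w' : B}
    (hu : Tw s a d u u') (hv : Tw s b d₁ v v') (hw : Tw s b' d₂ w w') (hd : d ≠ 0)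
    (hd₁ : d₁ ≠ 0) (hd₂ : d₂ ≠ 0) (hσ : σ * σ = 1)
    (h1 : σ * q = t₁ * sgn (pr b a)) (h2 : -σ * q⁻¹ = t₂ * (sgn (pr b b') * sgn (pr a b')))
    (h3 : 1 = t₃ * (sgn (pr a b) * sgn (pr a b')))
    (huu : u * u = 0) (hvw : v * w = w * v) :
    u * v * u * w - u * w * u * v + (σ * qint 2) • (u * v * w * u) - v * u * w * u
        + w * u * v * u = 0 ↔
      QOsp.br u' (QOsp.br (QOsp.br v' u' t₁) w' t₂) t₃ = 0 := by
  rw [quartic_eq_br u v w qint_two hσ q_ne_zero huu hvw]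
  refine (hu.br ((hv.br hu _ _ h1).br hw _ _ ?_) _ _ ?_).eq_zero_iff ?_
  · rw [pr_mul_left, map_mul, h2]
  · rw [pr_mul_right, pr_mul_right, pr_self, mul_one, map_mul, h3]
  · simp [hd, hd₁, hd₂, sgn_ne_zero]

/-- The cubic relator is not a single bracket, but it is antisymmetric in `u` and `v`: it is one
double bracket minus the same with `u` and `v` exchanged. With `a = ±q` and `b = ∓q⁻¹` the middle
coefficient `a - b` is `±[2]`. -/
theorem d_cubic_eq_br (u v w : B) {a b t : Kq} (h : b * a = -1) (ht : t = a - b) :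
    u * v * w - v * u * w + t • (v * w * u - u * w * v) + w * u * v - w * v * u =
      b • (br (br u w a) v (-a) - br (br v w a) u (-a)) := by
  subst ht
  simp only [QOsp.br, mul_sub, sub_mul, smul_sub, mul_smul_comm, smul_mul_assoc, smul_smul,
    mul_assoc, neg_smul, mul_neg, sub_neg_eq_add, smul_neg, ← mul_assoc b, h]
  module

end Transfer

/-! ### Transfer of each relation under a twist. -/

section Transfer

variable {B : Type} [Ring B] [Algebra Kq B] {X : DType} {ε : Parity n} {s : SGroup n →* B}
  {g : ℕ → SGroup n} {c : ℕ → Kq} {x y : ℕ → B}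

theorem eps_ne_cases (ε : Parity n) {i j : ℕ} (h : eps ε i ≠ eps ε j) :
    (eps ε i = 0 ∧ eps ε j = 1) ∨ (eps ε i = 1 ∧ eps ε j = 0) := by
  rcases eps_zero_or_one ε i with h0 | h0 <;> rcases eps_zero_or_one ε j with h1 | h1 <;>
    simp_all

theorem TwFam.serre_iff (h : TwFam X ε s g c x y) {i j : ℕ} (hi : 1 ≤ i) (hi' : i < n)
    (hj : 1 ≤ j) (hj' : j < n) (hij : i + 1 = j ∨ j + 1 = i)
    (he : eps ε i = eps ε (i + 1)) :
    x i * x i * x j - ((-1) ^ eps ε i * qint 2) • (x i * x j * x i) + x j * x i * x i = 0 ↔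
      y i * y i * y j - qint 2 • (y i * y j * y i) + y j * y i * y i = 0 := by
  rw [qint_two]
  refine (h.tw i hi').serre_iff (h.tw j hj') (h.ne i) (h.ne j) q_ne_zero ?_
  rcases hij with rfl | rfl
  · rw [h.pr_adj hi hj', p_of_pos X ε hi hi', if_pos he, zero_mul, pow_zero, one_mul, sgn_us, he]
  · rw [h.pr_adj' hj hi', p_of_pos X ε hi hi', if_pos he, mul_zero, pow_zero, one_mul, sgn_us]

/-- The two quadratic relations on the `x` side put the quartic relator in bracket form; on the `y`
side it already has that form. The three sign conditions follow from `p(i) = 1` and the pairings of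
the three nodes: adjacent ones contribute the parity of the shared index, and the outer two only
their super sign. -/
theorem TwFam.quartic_iff (h : TwFam X ε s g c x y) {i : ℕ} (hi : 2 ≤ i) (hi' : i + 2 ≤ n)
    (he : eps ε i ≠ eps ε (i + 1)) (hsq : x i * x i = 0)
    (hcomm : br (x (i - 1)) (x (i + 1)) 1 = 0) :
    x i * x (i - 1) * x i * x (i + 1) - x i * x (i + 1) * x i * x (i - 1)
        + ((-1) ^ eps ε i * qint 2) • (x i * x (i - 1) * x (i + 1) * x i)
        - x (i - 1) * x i * x (i + 1) * x i + x (i + 1) * x i * x (i - 1) * x i = 0 ↔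
      br (y i)
          (br (br (y (i - 1)) (y i) ((-1) ^ p X ε (i - 1) * q)) (y (i + 1))
            ((-1) ^ ((p X ε (i - 1) + p X ε i) * p X ε (i + 1)) * q⁻¹))
          ((-1) ^ (p X ε (i - 1) + p X ε i + p X ε (i + 1))) = 0 := by
  obtain ⟨i, rfl⟩ : ∃ k, i = k + 1 := ⟨i - 1, by omega⟩
  simp only [Nat.add_sub_cancel] at *
  have hf := form_α_α_of_far X ε (i := i) (j := i + 1 + 1) (by omega) (by omega) (by omega)
  refine (h.tw (i + 1) (by omega)).quartic_iff (h.tw i (by omega)) (h.tw (i + 1 + 1) (by omega))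
    (h.ne _) (h.ne _) (h.ne _) ?_ ?_ ?_ ?_ hsq (by simpa [br, sub_eq_zero] using hcomm)
  · rw [← mul_pow]; simp
  · rw [h.pr_adj (by omega) (by omega), p_of_pos X ε (i := i + 1) (by omega) (by omega), if_neg he,
      map_mul, map_pow, sgn_neg_one, sgn_us, mul_one]
    rcases eps_ne_cases ε he with ⟨h0, -⟩ | ⟨h0, -⟩ <;> rw [h0] <;>
      rcases Nat.even_or_odd (p X ε i) with h1 | h1 <;> simp [h1.neg_one_pow]
  · rw [h.pr_of_form (by omega) (by omega) (by omega) (by omega) hf,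
      h.pr_adj (by omega) (by omega), p_of_pos X ε (i := i + 1) (by omega) (by omega), if_neg he,
      map_mul, map_pow, map_pow, sgn_neg_one, sgn_us, add_mul, pow_add, one_mul]
    rcases eps_ne_cases ε he with ⟨h0, h0'⟩ | ⟨h0, h0'⟩ <;> rw [h0, h0'] <;>
      rcases Nat.even_or_odd (p X ε i * p X ε (i + 1 + 1)) with h1 | h1 <;>
      rcases Nat.even_or_odd (p X ε (i + 1 + 1)) with h2 | h2 <;>
      simp [h1.neg_one_pow, h2.neg_one_pow]
  · rw [h.pr_adj (by omega) (by omega), h.pr_adj' (by omega) (by omega),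
      p_of_pos X ε (i := i + 1) (by omega) (by omega), if_neg he,
      map_mul, map_mul, map_pow, map_pow, sgn_neg_one, sgn_us, sgn_us, pow_add, pow_add, one_mul,
      mul_one]
    rcases eps_ne_cases ε he with ⟨h0, h0'⟩ | ⟨h0, h0'⟩ <;> rw [h0, h0'] <;>
      rcases Nat.even_or_odd (p X ε i) with h1 | h1 <;>
      rcases Nat.even_or_odd (p X ε (i + 1 + 1)) with h2 | h2 <;>
      simp [h1.neg_one_pow, h2.neg_one_pow]

theorem TwFam.d_serre02_iff (h : TwFam DType.D ε s g c x y) (hn : 4 ≤ n)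
    (he : eps ε 1 = eps ε 2) :
    x 0 * x 0 * x 2 - ((-1) ^ eps ε 2 * qint 2) • (x 0 * x 2 * x 0) + x 2 * x 0 * x 0 = 0 ↔
      y 0 * y 0 * y 2 - qint 2 • (y 0 * y 2 * y 0) + y 2 * y 0 * y 0 = 0 := by
  rw [qint_two]
  refine (h.tw_D_zero (by omega)).serre_iff (h.tw 2 (by omega)) (h.ne _) (h.ne _) q_ne_zero ?_
  rw [h.pr_adj le_rfl (by omega), p_of_pos DType.D ε (i := 1) le_rfl (by omega), if_pos he,
    zero_mul, pow_zero, one_mul, sgn_us]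

theorem TwFam.d_serre20_iff (h : TwFam DType.D ε s g c x y) (hn : 4 ≤ n)
    (he : eps ε 2 = eps ε 3) :
    x 2 * x 2 * x 0 - ((-1) ^ eps ε 2 * qint 2) • (x 2 * x 0 * x 2) + x 0 * x 2 * x 2 = 0 ↔
      y 2 * y 2 * y 0 - qint 2 • (y 2 * y 0 * y 2) + y 0 * y 2 * y 2 = 0 := by
  rw [qint_two]
  refine (h.tw 2 (by omega)).serre_iff (h.tw_D_zero (by omega)) (h.ne _) (h.ne _) q_ne_zero ?_
  rw [h.pr_adj' le_rfl (by omega), p_of_pos DType.D ε (i := 2) (by omega) (by omega), if_pos he,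
    mul_zero, pow_zero, one_mul, sgn_us]

theorem TwFam.d_quartic_iff (h : TwFam DType.D ε s g c x y) (hn : 4 ≤ n)
    (he : eps ε 2 ≠ eps ε 3) (hsq : x 2 * x 2 = 0) (hcomm : br (x 3) (x 0) 1 = 0) :
    x 0 * x 2 * x 3 * x 2 - x 3 * x 2 * x 0 * x 2
        + ((-1) ^ eps ε 3 * qint 2) • (x 2 * x 3 * x 0 * x 2)
        - x 2 * x 0 * x 2 * x 3 + x 2 * x 3 * x 2 * x 0 = 0 ↔
      br (y 2)
          (br (br (y 3) (y 2) ((-1) ^ p DType.D ε 3 * q)) (y 0)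
            ((-1) ^ ((p DType.D ε 3 + p DType.D ε 2) * p DType.D ε 0) * q⁻¹))
          ((-1) ^ (p DType.D ε 3 + p DType.D ε 2 + p DType.D ε 0)) = 0 := by
  have hf := form_α_α_of_far DType.D ε (i := 1) (j := 3) (by omega) (by omega) (by omega)
  have h31 : pr (chi DType.D ε 3, g 3) (chi DType.D ε 1, g 1) =
      (-1) ^ (p DType.D ε 3 * p DType.D ε 1) := by
    rw [pr_comm, h.pr_of_form (by omega) (by omega) (by omega) (by omega) hf, mul_comm]
  rw [p_D_zero ε (by omega)]
  refine Iff.trans ?_ ((h.tw 2 (by omega)).quartic_iff (h.tw 3 (by omega))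
    (h.tw_D_zero (by omega)) (σ := (-1) ^ eps ε 3)
    (h.ne _) (h.ne _) (h.ne _) ?_ ?_ ?_ ?_ hsq (by simpa [br, sub_eq_zero] using hcomm))
  -- This is the general quartic relator for the chain 3, 2, 0, with its terms listed in another
  -- order.
  · refine Eq.congr ?_ rfl
    abel
  · rw [← mul_pow]; simp
  · rw [h.pr_adj' (by omega) (by omega), p_of_pos DType.D ε (i := 2) (by omega) (by omega),
      if_neg he, map_mul, map_pow, sgn_neg_one, sgn_us, one_mul]
    rcases eps_ne_cases ε he with ⟨-, h0⟩ | ⟨-, h0⟩ <;> rw [h0] <;>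
      rcases Nat.even_or_odd (p DType.D ε 3) with h1 | h1 <;> simp [h1.neg_one_pow]
  · rw [h31, h.pr_adj' le_rfl (by omega), p_of_pos DType.D ε (i := 2) (by omega) (by omega),
      if_neg he, map_mul, map_pow, map_pow, sgn_neg_one, sgn_us, add_mul, pow_add, one_mul,
      mul_one]
    rcases eps_ne_cases ε he with ⟨h0, h0'⟩ | ⟨h0, h0'⟩ <;> rw [h0, h0'] <;>
      rcases Nat.even_or_odd (p DType.D ε 3 * p DType.D ε 1) with h1 | h1 <;>
      rcases Nat.even_or_odd (p DType.D ε 1) with h2 | h2 <;>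
      simp [h1.neg_one_pow, h2.neg_one_pow]
  · rw [h.pr_adj' le_rfl (by omega), h.pr_adj (by omega) (by omega),
      p_of_pos DType.D ε (i := 2) (by omega) (by omega), if_neg he,
      map_mul, map_mul, map_pow, map_pow, sgn_neg_one, sgn_us, sgn_us, pow_add, pow_add, one_mul,
      mul_one]
    rcases eps_ne_cases ε he with ⟨h0, h0'⟩ | ⟨h0, h0'⟩ <;> rw [h0, h0'] <;>
      rcases Nat.even_or_odd (p DType.D ε 1) with h1 | h1 <;>
      rcases Nat.even_or_odd (p DType.D ε 3) with h2 | h2 <;>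
      simp [h1.neg_one_pow, h2.neg_one_pow]

/-- Nodes 0 and 1 share weight and scalar, so the two double brackets are twisted by the same group
element and the same scalar, and their difference is twisted as well. The sign `(-1)^{ε_3}`
separating the two relations is the pairing of nodes 1 and 2 when `ε_1 ≠ ε_2`. -/
theorem TwFam.d_cubic_iff (h : TwFam DType.D ε s g c x y) (hn : 4 ≤ n)
    (he : eps ε 1 ≠ eps ε 2) :
    x 0 * x 1 * x 2 - x 1 * x 0 * x 2
        + ((-1) ^ eps ε 2 * qint 2) • (x 1 * x 2 * x 0 - x 0 * x 2 * x 1)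
        + x 2 * x 0 * x 1 - x 2 * x 1 * x 0 = 0 ↔
      y 0 * y 1 * y 2 - y 1 * y 0 * y 2
        + ((-1) ^ (eps ε 2 + eps ε 3) * qint 2) • (y 1 * y 2 * y 0 - y 0 * y 2 * y 1)
        + y 2 * y 0 * y 1 - y 2 * y 1 * y 0 = 0 := by
  have hq := q_ne_zero
  have sq : ∀ k : ℕ, ((-1 : Kq) ^ k) * (-1) ^ k = 1 := fun k => by rw [← mul_pow]; simp
  have key : ∀ k : ℕ, (-((-1) ^ k * q⁻¹)) * ((-1) ^ k * q) = -1 := fun k => by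
    field_simp; linear_combination -sq k
  rw [d_cubic_eq_br (x 0) (x 1) (x 2) (key (eps ε 2)) (by rw [qint_two]; ring),
    d_cubic_eq_br (y 0) (y 1) (y 2) (key (eps ε 2 + eps ε 3)) (by rw [qint_two]; ring),
    smul_eq_zero_iff_right (by simp [hq]), smul_eq_zero_iff_right (by simp [hq])]
  have h12 : sgn (pr (chi DType.D ε 1, g 1) (chi DType.D ε 2, g 2)) = (-1) ^ eps ε 3 := by
    rw [h.pr_adj le_rfl (by omega), p_of_pos DType.D ε (i := 1) le_rfl (by omega), if_neg he,
      p_of_pos DType.D ε (i := 2) (by omega) (by omega), map_mul, map_pow, sgn_us, sgn_neg_one]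
    rcases eps_zero_or_one ε 2 with h0 | h0 <;> rcases eps_zero_or_one ε 3 with h1 | h1 <;>
      simp [h0, h1]
  have hc : (-1 : Kq) ^ eps ε 2 * q =
      (-1) ^ (eps ε 2 + eps ε 3) * q *
        sgn (pr (chi DType.D ε 1, g 1) (chi DType.D ε 2, g 2)) := by
    rw [h12, pow_add]; linear_combination (-(-1 : Kq) ^ eps ε 2 * q) * sq (eps ε 3)
  have h0 := h.tw_D_zero (by omega)
  have h1 := h.tw 1 (by omega)
  have h2 := h.tw 2 (by omega)
  have ht : -((-1 : Kq) ^ eps ε 2 * q) = -((-1) ^ (eps ε 2 + eps ε 3) * q) *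
      sgn (pr ((chi DType.D ε 1, g 1) * (chi DType.D ε 2, g 2)) (chi DType.D ε 1, g 1)) := by
    rw [pr_mul_left, pr_self, one_mul, pr_comm, hc]; ring
  refine (((h0.br h2 _ _ hc).br h1 _ _ ht).sub ((h1.br h2 _ _ hc).br h0 _ _ ht)).eq_zero_iff ?_
  simp [h.ne, sgn_ne_zero]

theorem TwFam.c_serre01_iff (h : TwFam DType.C ε s g c x y) (hn : 4 ≤ n) :
    x 0 * x 0 * x 1 - (q ^ 2 + (q ^ 2)⁻¹) • (x 0 * x 1 * x 0) + x 1 * x 0 * x 0 = 0 ↔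
      y 0 * y 0 * y 1 - (q ^ 2 + (q ^ 2)⁻¹) • (y 0 * y 1 * y 0) + y 1 * y 0 * y 0 = 0 := by
  have h1 := (h.tw 0 (by omega)).serre_iff (h.tw 1 (by omega)) (h.ne 0) (h.ne 1)
    (pow_ne_zero 2 q_ne_zero) (σ := 1) (by rw [h.pr_C_zero' (by omega), map_one])
  rwa [one_mul] at h1

/-- The quartic Serre operator factors with parameters `q²`, `1`, `q⁻²`, whose sum is `[3]`. -/
theorem c_serre10_eq_br (u v : B) {a b t : Kq} (h : b * a = 1) (ht : t = a + 1 + b) :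
    u * u * u * v - t • (u * u * v * u) + t • (u * v * u * u) - v * u * u * u =
      br u (br u (br u v a) 1) b := by
  subst ht
  simp only [br, mul_sub, sub_mul, smul_sub, mul_smul_comm, smul_mul_assoc, smul_smul,
    mul_assoc, one_smul, one_mul, h]
  module

theorem TwFam.c_serre10_iff (h : TwFam DType.C ε s g c x y) (hn : 4 ≤ n) :
    x 1 * x 1 * x 1 * x 0 - qint 3 • (x 1 * x 1 * x 0 * x 1)
        + qint 3 • (x 1 * x 0 * x 1 * x 1) - x 0 * x 1 * x 1 * x 1 = 0 ↔
      y 1 * y 1 * y 1 * y 0 - qint 3 • (y 1 * y 1 * y 0 * y 1)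
        + qint 3 • (y 1 * y 0 * y 1 * y 1) - y 0 * y 1 * y 1 * y 1 = 0 := by
  have h0 := h.tw 0 (by omega)
  have h1 := h.tw 1 (by omega)
  have h10 := h.pr_C_zero (i := 1) (by omega)
  have hq : (q ^ 2)⁻¹ * q ^ 2 = 1 := inv_mul_cancel₀ (pow_ne_zero 2 q_ne_zero)
  rw [c_serre10_eq_br _ _ hq qint_three, c_serre10_eq_br _ _ hq qint_three]
  refine (h1.br (h1.br (h1.br h0 _ _ ?_) _ _ ?_) _ _ ?_).eq_zero_iff ?_
  · rw [h10, map_one, mul_one]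
  · simp only [h10, pr_mul_right, pr_self, map_one, mul_one]
  · simp only [h10, pr_mul_right, pr_self, map_one, mul_one]
  · simp [h.ne, sgn_ne_zero]

/-- Only the inner bracket changes by a sign, the pairing of the adjacent odd nodes 1 and 2. The
parameter with `x 0` involves `q_1` squared, whose sign disappears, and in the outer brackets every
pairing of distinct positive nodes occurs an even number of times. -/
theorem TwFam.c_sextic_iff (h : TwFam DType.C ε s g c x y) (hn : 4 ≤ n)
    (he : eps ε 1 ≠ eps ε 2) (he' : eps ε 2 ≠ eps ε 3) :
    br (br (br (br (x 2) (x 1) (qi ε 2)) (x 0) (qi ε 1 ^ 2)) (br (x 2) (x 1) (qi ε 2)) 1)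
          (x 1) 1 = 0 ↔
      br (br (br (br (y 2) (y 1) (-q ^ ((-1 : ℤ) ^ eps ε 2)))
            (y 0) (q ^ (2 * (-1 : ℤ) ^ eps ε 1)))
          (br (y 2) (y 1) (-q ^ ((-1 : ℤ) ^ eps ε 2))) 1) (y 1) 1 = 0 := by
  have h0 := h.tw 0 (by omega)
  have h1 := h.tw 1 (by omega)
  have h2 := h.tw 2 (by omega)
  have h10 := h.pr_C_zero (i := 1) (by omega)
  have h20 := h.pr_C_zero (i := 2) (by omega)
  have h01 := h.pr_C_zero' (i := 1) (by omega)
  have h02 := h.pr_C_zero' (i := 2) (by omega)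
  have h21 := h.pr_adj' (i := 1) le_rfl (by omega)
  have h12 := h.pr_adj (i := 1) le_rfl (by omega)
  rw [p_of_pos DType.C ε le_rfl (by omega), p_of_pos DType.C ε (i := 1 + 1) (by omega) (by omega),
    if_neg he, if_neg he', mul_one, pow_one] at h21 h12
  norm_num only at h21 h12
  have ha := h2.br h1 (qi ε 2) (-q ^ ((-1 : ℤ) ^ eps ε 2)) (by
    rw [h21, map_mul, sgn_us, sgn_neg_one, qi]; ring)
  refine (((ha.br h0 _ _ ?_).br ha _ _ ?_).br h1 _ _ ?_).eq_zero_iff ?_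
  · simp only [pr_mul_left, h10, h20, map_one, mul_one, qi, mul_pow, ← pow_mul]
    rw [mul_comm 2 ((-1 : ℤ) ^ eps ε 1), zpow_mul]
    norm_cast
    simp [mul_comm (eps ε 1) 2, pow_mul]
  · simp only [pr_mul_left, pr_mul_right, h01, h02, h21, h12, pr_self]
    simp
  · simp only [pr_mul_left, h01, h21, pr_self]
    simp
  · simp [h.ne, sgn_ne_zero]

/-- The brackets are transferred from the inside out. Node 0 contributes nothing and repeated
letters cancel in pairs, so the sign at each stage is a product of the pairings of nodes 3 and 2, 3
and 1, and 2 and 1, where node 1 is odd and node 2 is even. -/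
theorem TwFam.c_septic_iff (h : TwFam DType.C ε s g c x y) (hn : 4 ≤ n)
    (he : eps ε 1 ≠ eps ε 2) (he' : eps ε 2 = eps ε 3) :
    br (br (br (br (br (br (x 3) (x 2) (qi ε 3)) (x 1) (qi ε 2)) (x 0) (qi ε 1 ^ 2))
          (x 1) (qi ε 1)) (x 2) (qi ε 2)) (x 1) 1 = 0 ↔
      br (br (br (br (br (br (y 3) (y 2) (q ^ ((-1 : ℤ) ^ eps ε 3)))
          (y 1) ((-1) ^ p DType.C ε 3 * q ^ ((-1 : ℤ) ^ eps ε 2)))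
          (y 0) (q ^ (2 * (-1 : ℤ) ^ eps ε 1)))
          (y 1) ((-1) ^ (p DType.C ε 3 + 1) * q ^ ((-1 : ℤ) ^ eps ε 1)))
          (y 2) (q ^ ((-1 : ℤ) ^ eps ε 2)))
          (y 1) ((-1) ^ p DType.C ε 3) = 0 := by
  have h0 := h.tw 0 (by omega)
  have h1 := h.tw 1 (by omega)
  have h2 := h.tw 2 (by omega)
  have h3 := h.tw 3 (by omega)
  have h10 := h.pr_C_zero (i := 1) (by omega)
  have h20 := h.pr_C_zero (i := 2) (by omega)
  have h30 := h.pr_C_zero (i := 3) (by omega)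
  have h01 := h.pr_C_zero' (i := 1) (by omega)
  have h02 := h.pr_C_zero' (i := 2) (by omega)
  have h21 := h.pr_adj' (i := 1) le_rfl (by omega)
  have h12 := h.pr_adj (i := 1) le_rfl (by omega)
  have h32 := h.pr_adj' (i := 2) (by omega) (by omega)
  have h31 := h.pr_of_form (i := 3) (j := 1) (by omega) (by omega) (by omega) (by omega)
    (by rw [form_comm]; exact form_α_α_of_far _ ε (by omega) (by omega) (by omega))
  norm_num only at h21 h12 h32
  have p1 : p DType.C ε 1 = 1 := by rw [p_of_pos DType.C ε le_rfl (by omega), if_neg he]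
  have p2 : p DType.C ε 2 = 0 := by
    rw [p_of_pos DType.C ε (i := 2) (by omega) (by omega), if_pos he']
  rw [p1, p2, mul_zero, pow_zero, one_mul] at h21 h12
  rw [p2, zero_mul, pow_zero, one_mul] at h32
  rw [p1, mul_one] at h31
  refine ((((((h3.br h2 _ _ ?_).br h1 _ _ ?_).br h0 _ _ ?_).br h1 _ _ ?_).br h2 _ _ ?_).br
    h1 _ _ ?_).eq_zero_iff ?_
  · rw [h32, sgn_us, qi, mul_comm]
  · rw [pr_mul_left, h31, h21, map_mul, map_pow, sgn_neg_one, sgn_us, qi]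
    rcases Nat.even_or_odd (p DType.C ε 3) with h4 | h4 <;> simp [h4.neg_one_pow, mul_comm]
  · simp only [pr_mul_left, h10, h20, h30, map_one, mul_one, qi, mul_pow, ← pow_mul]
    rw [mul_comm 2 ((-1 : ℤ) ^ eps ε 1), zpow_mul]
    norm_cast
    simp [mul_comm (eps ε 1) 2, pow_mul]
  · simp only [pr_mul_left, h31, h21, h01, pr_self, mul_one, map_mul, map_pow, sgn_neg_one, sgn_us,
      qi, pow_succ]
    -- The pairing of nodes 2 and 1 gives `(-1)^{ε_2}`, while `q_1` has the sign `(-1)^{ε_1}`. These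
    -- are opposite, whence the additional `1` in the exponent `p(3) + 1`.
    rcases eps_ne_cases ε he with ⟨h5, h6⟩ | ⟨h5, h6⟩ <;>
    rcases Nat.even_or_odd (p DType.C ε 3) with h4 | h4 <;> simp [h4.neg_one_pow, h5, h6]
  · simp only [pr_mul_left, h32, h12, h02, pr_self, mul_one, qi]
    rw [mul_assoc (us ε 3), us_mul_self, mul_one, sgn_us, he', mul_comm]
  · simp only [pr_mul_left, h31, h21, h01, pr_self, mul_one, map_mul, map_pow, sgn_neg_one, sgn_us]
    rcases eps_zero_or_one ε 2 with h5 | h5 <;>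
    rcases Nat.even_or_odd (p DType.C ε 3) with h4 | h4 <;> simp [h4.neg_one_pow, h5]
  · simp [h.ne, sgn_ne_zero]

/-- The two sets of Serre relations are equivalent for two families related by a twist. -/
theorem TwFam.serre_relations_iff (h : TwFam X ε s g c x y) (hn : 4 ≤ n) :
    (∀ r, GQSerre X ε x r → r = 0) ↔ ∀ r, YQSerre X ε y r → r = 0 := by
  constructor
  · intro hx r hr
    cases hr with
    | sq i hi h0 => exact (h.sq_iff hi).1 (hx _ (.sq i hi h0))
    | comm i j hi hj h0 =>
      by_cases hij : i = j
      · subst hij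
        rw [br, (h.sq_iff hi).1 (hx _ (.sq i hi h0)), smul_zero, sub_zero]
      · exact (h.comm_iff (by omega) hi hj hij h0).1 (hx _ (.comm i j hi hj h0))
    | serre i j hi hi' hj hj' hij he =>
      exact (h.serre_iff hi hi' hj hj' hij he).1 (hx _ (.serre i j hi hi' hj hj' hij he))
    | quartic i hi hi' he =>
      exact (h.quartic_iff hi hi' he
        (hx _ (.sq i (by omega) ((form_α_self_eq_zero_iff X ε (by omega) (by omega)).2 he)))
        (hx _ (.comm (i - 1) (i + 1) (by omega) (by omega)
          (form_α_α_of_far X ε (by omega) (by omega) (by omega))))).1 (hx _ (.quartic i hi hi' he))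
    | d_serre20 hX he => subst hX; exact (h.d_serre20_iff hn he).1 (hx _ (.d_serre20 rfl he))
    | d_serre02 hX he => subst hX; exact (h.d_serre02_iff hn he).1 (hx _ (.d_serre02 rfl he))
    | d_quartic hX he =>
      subst hX
      exact (h.d_quartic_iff hn he
        (hx _ (.sq 2 (by omega) ((form_α_self_eq_zero_iff _ ε (by omega) (by omega)).2 he)))
        (hx _ (.comm 3 0 (by omega) (by omega)
          (by rw [form_comm]; exact form_α_D_zero_of_far ε (by omega) le_rfl)))).1
        (hx _ (.d_quartic rfl he))
    | d_cubic hX he => subst hX; exact (h.d_cubic_iff hn he).1 (hx _ (.d_cubic rfl he))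
    | c_serre10 hX he => subst hX; exact (h.c_serre10_iff hn).1 (hx _ (.c_serre10 rfl he))
    | c_serre01 hX => subst hX; exact (h.c_serre01_iff hn).1 (hx _ (.c_serre01 rfl))
    | c_sextic hX he he' =>
      subst hX; exact (h.c_sextic_iff hn he he').1 (hx _ (.c_sextic rfl he he'))
    | c_septic hX he he' =>
      subst hX; exact (h.c_septic_iff hn he he').1 (hx _ (.c_septic rfl he he'))
  · intro hy r hr
    have hsq : ∀ i < n, form ε (α X i) (α X i) = 0 → x i * x i = 0 := fun i hi h0 =>
      (h.sq_iff hi).2 (hy _ (.sq i hi h0))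
    have hcomm : ∀ i j, i < n → j < n → form ε (α X i) (α X j) = 0 → br (x i) (x j) 1 = 0 := by
      intro i j hi hj h0
      by_cases hij : i = j
      · subst hij
        rw [br, hsq i hi h0, smul_zero, sub_zero]
      · exact (h.comm_iff (by omega) hi hj hij h0).2 (hy _ (.comm i j hi hj h0))
    cases hr with
    | sq i hi h0 => exact hsq i hi h0
    | comm i j hi hj h0 => exact hcomm i j hi hj h0
    | serre i j hi hi' hj hj' hij he =>
      exact (h.serre_iff hi hi' hj hj' hij he).2 (hy _ (.serre i j hi hi' hj hj' hij he))
    | quartic i hi hi' he =>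
      exact (h.quartic_iff hi hi' he
        (hsq i (by omega) ((form_α_self_eq_zero_iff X ε (by omega) (by omega)).2 he))
        (hcomm (i - 1) (i + 1) (by omega) (by omega)
          (form_α_α_of_far X ε (by omega) (by omega) (by omega)))).2 (hy _ (.quartic i hi hi' he))
    | d_serre20 hX he => subst hX; exact (h.d_serre20_iff hn he).2 (hy _ (.d_serre20 rfl he))
    | d_serre02 hX he => subst hX; exact (h.d_serre02_iff hn he).2 (hy _ (.d_serre02 rfl he))
    | d_quartic hX he =>
      subst hX
      exact (h.d_quartic_iff hn he
        (hsq 2 (by omega) ((form_α_self_eq_zero_iff _ ε (by omega) (by omega)).2 he))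
        (hcomm 3 0 (by omega) (by omega)
          (by rw [form_comm]; exact form_α_D_zero_of_far ε (by omega) le_rfl))).2
        (hy _ (.d_quartic rfl he))
    | d_cubic hX he => subst hX; exact (h.d_cubic_iff hn he).2 (hy _ (.d_cubic rfl he))
    | c_serre10 hX he => subst hX; exact (h.c_serre10_iff hn).2 (hy _ (.c_serre10 rfl he))
    | c_serre01 hX => subst hX; exact (h.c_serre01_iff hn).2 (hy _ (.c_serre01 rfl))
    | c_sextic hX he he' =>
      subst hX; exact (h.c_sextic_iff hn he he').2 (hy _ (.c_sextic rfl he he'))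
    | c_septic hX he he' =>
      subst hX; exact (h.c_septic_iff hn he he').2 (hy _ (.c_septic rfl he he'))

end Transfer

/-! ### The group elements attached to the weight lattice -/

/-- The group element attached to `δ_j`. -/
def pg (ε : Parity n) (j : ℕ) : SGroup n := sg 1 * ∏ l ∈ Finset.Ico 1 j, kPart ε l

/-- The homomorphism from the weight lattice to the sign group which extends `α_i ↦ gK X ε i`. -/
def piK (ε : Parity n) (μ : Wt n) : SGroup n := ∏ l : Idx n, pg ε l ^ μ l

theorem piK_zero (ε : Parity n) : piK ε 0 = 1 := by simp [piK]

theorem piK_add (ε : Parity n) (μ ν : Wt n) : piK ε (μ + ν) = piK ε μ * piK ε ν := by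
  simp [piK, zpow_add, Finset.prod_mul_distrib]

theorem piK_neg (ε : Parity n) (μ : Wt n) : piK ε (-μ) = piK ε μ := by
  rw [← SGroup.inv_eq (piK ε μ), eq_inv_iff_mul_eq_one, ← piK_add, neg_add_cancel, piK_zero]

theorem piK_sub (ε : Parity n) (μ ν : Wt n) : piK ε (μ - ν) = piK ε μ * piK ε ν := by
  rw [sub_eq_add_neg, piK_add, piK_neg]

theorem piK_δ (ε : Parity n) {j : ℕ} (hj : 1 ≤ j) (hj' : j ≤ n) : piK ε (δ j) = pg ε j := by
  rw [piK, Finset.prod_eq_single ⟨j, Finset.mem_Icc.2 ⟨hj, hj'⟩⟩]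
  · simp [δ]
  · intro l _ hl
    have : (l : ℕ) ≠ j := fun h => hl (Subtype.ext h)
    simp [δ, this]
  · simp

theorem pg_succ (ε : Parity n) {j : ℕ} (hj : 1 ≤ j) : pg ε (j + 1) = pg ε j * kPart ε j := by
  rw [pg, pg, Finset.prod_Ico_succ_top hj, mul_assoc]

/-- All elements are involutions, so only the product of `pg ε i` and `pg ε (i + 1)` matters, and it
telescopes to `kPart ε i`. The roots `-δ_1 - δ_2` and `-2δ_1` yield `kPart ε 1` and a square. -/
theorem piK_α (X : DType) (ε : Parity n) (hn : 2 ≤ n) {i : ℕ} (hi : i < n) :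
    piK ε (α X i) = gK X ε i := by
  have h12 : pg ε 1 * pg ε 2 = kPart ε 1 := by
    rw [pg_succ ε le_rfl, ← mul_assoc, SGroup.mul_self, one_mul]
  rcases Nat.eq_zero_or_pos i with rfl | hi0
  · cases X with
    | C =>
      rw [α_C_zero, piK_neg, two_smul, piK_add, SGroup.mul_self, gK_C_zero]
    | D =>
      rw [α_D_zero, piK_sub, piK_neg, piK_δ ε le_rfl (by omega), piK_δ ε (by omega) hn, h12,
        gK_D_zero, gK_of_pos _ ε le_rfl]
  · rw [α_of_pos X hi0, piK_sub, piK_δ ε hi0 hi.le, piK_δ ε (by omega) hi, pg_succ ε hi0,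
      ← mul_assoc, SGroup.mul_self, one_mul, gK_of_pos X ε hi0]

/-- Since `kPart ε l` acts as `σ_l σ_{l+1}`, the action of the product telescopes from `σ_1` to
`σ_j`; this is what the initial factor `sg 1` in `pg` is for. The two group elements themselves may
differ. -/
theorem chi_pg (X : DType) (ε : Parity n) (i : ℕ) {j : ℕ} (hj : 1 ≤ j) :
    chi X ε i (pg ε j) = chi X ε i (sg j) := by
  induction j, hj using Nat.le_induction with
  | base => simp [pg]
  | succ j hj ih =>
    rw [pg_succ ε hj, map_mul, ih, chi_kPart, chi_vs, ← mul_assoc, Int.units_mul_self, one_mul]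

/-- Both sides are products over the coordinates. In coordinate `l`, `q_l` differs from `q^{±1}`
only by `(-1)^{ε_l}`, and its power `μ_l (α_i)_l` is the sign by which `σ_l^{μ_l}` acts on `e_i`. -/
theorem bq_eq (X : DType) (ε : Parity n) (μ : Wt n) (i : ℕ) :
    bq ε μ (α X i) = sgn (chi X ε i (piK ε μ)) * q ^ form ε μ (α X i) := by
  have hq := q_ne_zero
  have hform : q ^ form ε μ (α X i) =
      ∏ l : Idx n, q ^ ((-1) ^ eps ε l * μ l * (α X i : Wt n) l) := by
    rw [form]
    induction (Finset.univ : Finset (Idx n)) using Finset.induction_on with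
    | empty => simp
    | insert a t ha ih => rw [Finset.sum_insert ha, Finset.prod_insert ha, zpow_add₀ hq, ih]
  rw [hform, piK, map_prod, map_prod, bq, ← Finset.prod_mul_distrib]
  refine Finset.prod_congr rfl fun l _ => ?_
  have hl := Finset.mem_Icc.1 l.2
  rw [map_zpow, chi_pg X ε i hl.1, chi_sg_nat X ε i l.2, form_δ_left ε l.2, qi, mul_zpow,
    ← zpow_mul, ← zpow_mul, ← mul_assoc ((-1 : ℤ) ^ eps ε l)]
  congr 1
  rcases eps_zero_or_one ε l with h | h
  · simp [h]
  · rw [h]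
    have h2 : ((1 : ℕ) : ℤ) * ((-1) ^ 1 * (α X i : Wt n) l) * μ l = -(μ l * (α X i : Wt n) l) := by
      push_cast; ring
    simp only [Subtype.coe_eta, h2]
    rw [pow_one, zpow_neg, map_inv]
    rcases Int.even_or_odd (μ l * (α X i : Wt n) l) with h3 | h3
    · simp [h3.neg_one_zpow]
    · simp [h3.neg_one_zpow]

/-! ### The scalars in the definition of `τ` -/

/-- The sign in `τ(F_m)` for `1 ≤ m`. -/
def fSign (ε : Parity n) (m : ℕ) : Kq :=
  if eps ε m = 0 then 1 else if eps ε (m + 1) = 0 then (-1) ^ (m - blk ε m) else -1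

/-- The scalar in `τ(E_i)`. -/
def cE (X : DType) (ε : Parity n) (i : ℕ) : Kq :=
  if i = 0 then
    match X with
    | DType.D => 1
    | DType.C => (-1) ^ eps ε 1
  else 1

/-- The scalar in `τ(F_i)`. -/
def cF (X : DType) (ε : Parity n) (i : ℕ) : Kq :=
  if i = 0 then
    match X with
    | DType.D => fSign ε 1
    | DType.C => 1
  else fSign ε i

theorem cE_of_pos (X : DType) (ε : Parity n) {i : ℕ} (hi : 1 ≤ i) : cE X ε i = 1 :=
  if_neg (by omega)

theorem cF_of_pos (X : DType) (ε : Parity n) {i : ℕ} (hi : 1 ≤ i) : cF X ε i = fSign ε i :=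
  if_neg (by omega)

theorem fSign_ne_zero (ε : Parity n) (m : ℕ) : fSign ε m ≠ 0 := by
  unfold fSign; split_ifs <;> simp

theorem cE_ne_zero (X : DType) (ε : Parity n) (i : ℕ) : cE X ε i ≠ 0 := by
  unfold cE
  split_ifs
  · cases X <;> simp
  · simp

theorem cF_ne_zero (X : DType) (ε : Parity n) (i : ℕ) : cF X ε i ≠ 0 := by
  unfold cF
  split_ifs
  · cases X
    · simp
    · exact fSign_ne_zero ε 1
  · exact fSign_ne_zero ε i

/-- This fixes the choice of signs in `τ(F_m)`: they compensate for moving the group element of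
`τ(E_m)` past `f_m`, up to the factor `(-1)^{ε_m}` required by the relation between `E_m` and `F_m`.
-/
theorem fSign_mul_chi (X : DType) (ε : Parity n) {m : ℕ} (hm : 1 ≤ m) :
    fSign ε m * sgn (chi X ε m (ePart ε m)) = (-1) ^ eps ε m := by
  unfold fSign ePart
  simp only [map_mul, apply_ite (chi X ε m), map_one, map_pow, chi_sle_self X ε hm,
    chi_vs_self X ε hm, us]
  rcases eps_zero_or_one ε m with h0 | h0 <;> rcases eps_zero_or_one ε (m + 1) with h1 | h1 <;>
    simp [h0, h1, ← mul_pow]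

theorem cE_mul_cF (X : DType) (ε : Parity n) (i : ℕ) :
    cE X ε i * cF X ε i * sgn (chi X ε i (gE X ε i)) =
      (-1) ^ (if i = 0 then eps ε 1 else eps ε i) := by
  rcases Nat.eq_zero_or_pos i with rfl | hi
  · cases X with
    | C => rw [gE_C_zero, map_one, map_one, mul_one, if_pos rfl]; exact mul_one _
    | D =>
      rw [chi_D_zero, gE_D_zero, gE_of_pos _ ε le_rfl, if_pos rfl, ← fSign_mul_chi DType.D ε le_rfl]
      exact congrArg (· * _) (one_mul _)
  · rw [gE_of_pos X ε hi, if_neg (by omega), ← fSign_mul_chi X ε hi, cE_of_pos X ε hi,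
      cF_of_pos X ε hi, one_mul]

/-- The group element in `τ(F_i)`. -/
def gF (X : DType) (ε : Parity n) (i : ℕ) : SGroup n := gE X ε i * gK X ε i

/-! ### Two homomorphisms related by the twist -/

section Naturality

variable {A B : Type} [Ring A] [Algebra Kq A] [Ring B] [Algebra Kq B]

/-- Relators are defined by the same expressions in every algebra, so homomorphisms carry relators
to relators. This moves the Serre relations from the free algebra to `B`, where the twist takes
place. -/
theorem GQSerre.forall_map_iff {X : DType} {ε : Parity n} {x : ℕ → A} (φ : A →ₐ[Kq] B) :
    (∀ r, GQSerre X ε x r → φ r = 0) ↔ ∀ r, GQSerre X ε (fun i => φ (x i)) r → r = 0 := by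
  constructor
  · intro h r hr
    cases hr with
    | comm i j a b d => simpa only [map_br] using h _ (.comm i j a b d)
    | sq i a b => simpa only [map_mul] using h _ (.sq i a b)
    | serre i j a b d e' f' g' =>
      simpa only [map_sub, map_add, map_mul, map_smul] using h _ (.serre i j a b d e' f' g')
    | quartic i a b d =>
      simpa only [map_sub, map_add, map_mul, map_smul] using h _ (.quartic i a b d)
    | d_serre02 a b =>
      simpa only [map_sub, map_add, map_mul, map_smul] using h _ (.d_serre02 a b)
    | d_serre20 a b =>
      simpa only [map_sub, map_add, map_mul, map_smul] using h _ (.d_serre20 a b)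
    | d_cubic a b =>
      simpa only [map_sub, map_add, map_mul, map_smul] using h _ (.d_cubic a b)
    | d_quartic a b =>
      simpa only [map_sub, map_add, map_mul, map_smul] using h _ (.d_quartic a b)
    | c_serre01 a =>
      simpa only [map_sub, map_add, map_mul, map_smul] using h _ (.c_serre01 a)
    | c_serre10 a b =>
      simpa only [map_sub, map_add, map_mul, map_smul] using h _ (.c_serre10 a b)
    | c_sextic a b d => simpa only [map_br] using h _ (.c_sextic a b d)
    | c_septic a b d => simpa only [map_br] using h _ (.c_septic a b d)
  · intro h r hr
    cases hr with
    | comm i j a b d => simpa only [map_br] using h _ (.comm i j a b d)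
    | sq i a b => simpa only [map_mul] using h _ (.sq i a b)
    | serre i j a b d e' f' g' =>
      simpa only [map_sub, map_add, map_mul, map_smul] using h _ (.serre i j a b d e' f' g')
    | quartic i a b d =>
      simpa only [map_sub, map_add, map_mul, map_smul] using h _ (.quartic i a b d)
    | d_serre02 a b =>
      simpa only [map_sub, map_add, map_mul, map_smul] using h _ (.d_serre02 a b)
    | d_serre20 a b =>
      simpa only [map_sub, map_add, map_mul, map_smul] using h _ (.d_serre20 a b)
    | d_cubic a b =>
      simpa only [map_sub, map_add, map_mul, map_smul] using h _ (.d_cubic a b)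
    | d_quartic a b =>
      simpa only [map_sub, map_add, map_mul, map_smul] using h _ (.d_quartic a b)
    | c_serre01 a =>
      simpa only [map_sub, map_add, map_mul, map_smul] using h _ (.c_serre01 a)
    | c_serre10 a b =>
      simpa only [map_sub, map_add, map_mul, map_smul] using h _ (.c_serre10 a b)
    | c_sextic a b d => simpa only [map_br] using h _ (.c_sextic a b d)
    | c_septic a b d => simpa only [map_br] using h _ (.c_septic a b d)

theorem YQSerre.forall_map_iff {X : DType} {ε : Parity n} {x : ℕ → A} (φ : A →ₐ[Kq] B) :
    (∀ r, YQSerre X ε x r → φ r = 0) ↔ ∀ r, YQSerre X ε (fun i => φ (x i)) r → r = 0 := by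
  constructor
  · intro h r hr
    cases hr with
    | comm i j a b d => simpa only [map_br] using h _ (.comm i j a b d)
    | sq i a b => simpa only [map_mul] using h _ (.sq i a b)
    | serre i j a b d e' f' g' =>
      simpa only [map_sub, map_add, map_mul, map_smul] using h _ (.serre i j a b d e' f' g')
    | quartic i a b d => simpa only [map_br] using h _ (.quartic i a b d)
    | d_serre02 a b =>
      simpa only [map_sub, map_add, map_mul, map_smul] using h _ (.d_serre02 a b)
    | d_serre20 a b =>
      simpa only [map_sub, map_add, map_mul, map_smul] using h _ (.d_serre20 a b)
    | d_cubic a b =>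
      simpa only [map_sub, map_add, map_mul, map_smul] using h _ (.d_cubic a b)
    | d_quartic a b => simpa only [map_br] using h _ (.d_quartic a b)
    | c_serre01 a =>
      simpa only [map_sub, map_add, map_mul, map_smul] using h _ (.c_serre01 a)
    | c_serre10 a b =>
      simpa only [map_sub, map_add, map_mul, map_smul] using h _ (.c_serre10 a b)
    | c_sextic a b d => simpa only [map_br] using h _ (.c_sextic a b d)
    | c_septic a b d => simpa only [map_br] using h _ (.c_septic a b d)
  · intro h r hr
    cases hr with
    | comm i j a b d => simpa only [map_br] using h _ (.comm i j a b d)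
    | sq i a b => simpa only [map_mul] using h _ (.sq i a b)
    | serre i j a b d e' f' g' =>
      simpa only [map_sub, map_add, map_mul, map_smul] using h _ (.serre i j a b d e' f' g')
    | quartic i a b d => simpa only [map_br] using h _ (.quartic i a b d)
    | d_serre02 a b =>
      simpa only [map_sub, map_add, map_mul, map_smul] using h _ (.d_serre02 a b)
    | d_serre20 a b =>
      simpa only [map_sub, map_add, map_mul, map_smul] using h _ (.d_serre20 a b)
    | d_cubic a b =>
      simpa only [map_sub, map_add, map_mul, map_smul] using h _ (.d_cubic a b)
    | d_quartic a b => simpa only [map_br] using h _ (.d_quartic a b)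
    | c_serre01 a =>
      simpa only [map_sub, map_add, map_mul, map_smul] using h _ (.c_serre01 a)
    | c_serre10 a b =>
      simpa only [map_sub, map_add, map_mul, map_smul] using h _ (.c_serre10 a b)
    | c_sextic a b d => simpa only [map_br] using h _ (.c_sextic a b d)
    | c_septic a b d => simpa only [map_br] using h _ (.c_septic a b d)

end Naturality

/-! ### Equivalence of the two full presentations under the twist. -/

section Twisted

theorem mul_s_cancel {B : Type} [Ring B] (s : SGroup n →* B) (g : SGroup n) {a b : B} :
    a * s g = b * s g ↔ a = b := by
  refine ⟨fun h => ?_, fun h => by rw [h]⟩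
  have h' := congrArg (· * s g⁻¹) h
  simpa only [mul_assoc, ← map_mul, mul_inv_cancel, map_one, mul_one] using h'

variable {B : Type} [Ring B] [Algebra Kq B] {X : DType} {ε : Parity n} {s : SGroup n →* B}
  {φ ψ : Free n →ₐ[Kq] B}

/-- The values of `ψ` on the generators are those of `φ`, twisted as in the definition of `τ`. -/
structure Twisted (X : DType) (ε : Parity n) (s : SGroup n →* B) (φ ψ : Free n →ₐ[Kq] B) :
    Prop where
  tw_e : ∀ i < n, Tw s (chi X ε i, gE X ε i) (cE X ε i) (φ (fe i)) (ψ (fe i))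
  tw_f : ∀ i < n, Tw s (chi X ε i, gF X ε i) (cF X ε i) (φ (ff i)) (ψ (ff i))
  comm_k : ∀ g μ, s g * φ (fk μ) = φ (fk μ) * s g
  eq_k : ∀ μ, ψ (fk μ) = φ (fk μ) * s (piK ε μ)

theorem Twisted.twFam_e (h : Twisted X ε s φ ψ) (hn : 2 ≤ n) :
    TwFam X ε s (gE X ε) (cE X ε) (fun i => φ (fe i)) (fun i => ψ (fe i)) where
  tw := h.tw_e
  ne := cE_ne_zero X ε
  pr_eq i hi j hj := chi_gE_mul X ε hn hi hj
  zero hX := by subst hX; exact ⟨rfl, rfl⟩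

/-- Relative to the weights of the `E_i`, the pairing gains `χ_j(gK_i) χ_i(gK_j)`, which is a square
by symmetry. So the `F` relations need no separate sign computation. -/
theorem Twisted.twFam_f (h : Twisted X ε s φ ψ) (hn : 2 ≤ n) :
    TwFam X ε s (gF X ε) (cF X ε) (fun i => φ (ff i)) (fun i => ψ (ff i)) where
  tw := h.tw_f
  ne := cF_ne_zero X ε
  pr_eq i hi j hj := by
    rw [← chi_gE_mul X ε hn hi hj, pr, gF, gF]
    simp only [map_mul]
    rw [chi_gK_comm X ε j i, mul_mul_mul_comm, Int.units_mul_self, mul_one]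
  zero hX := by subst hX; exact ⟨rfl, rfl⟩

/-- The twists of `k_μ` and `k_{-μ}` carry the same involution `piK ε μ`. Its two occurrences cancel
after one of them has passed `u`, leaving the sign `a.1 (piK ε μ)`. -/
theorem Twisted.conj_iff (h : Twisted X ε s φ ψ) {a : Weight n} {d t t' : Kq} {u v : B}
    (hu : Tw s a d u v) (hd : d ≠ 0) (μ : Wt n) (ht : t = sgn (a.1 (piK ε μ)) * t') :
    φ (fk μ) * u * φ (fk (-μ)) = t • u ↔ ψ (fk μ) * v * ψ (fk (-μ)) = t' • v := by
  have h1 : ψ (fk μ) * v * ψ (fk (-μ)) =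
      (d * sgn (a.1 (piK ε μ))) • (φ (fk μ) * u * φ (fk (-μ)) * s a.2) := by
    rw [h.eq_k, h.eq_k, hu.eq, piK_neg]
    -- The group element is moved past `u`, where it costs a sign, and then past `φ (fk (-μ))` for
    -- free, to meet its own inverse.
    have h2 : s (piK ε μ) * (u * (s a.2 * (φ (fk (-μ)) * s (piK ε μ)))) =
        sgn (a.1 (piK ε μ)) • (u * (φ (fk (-μ)) * s a.2)) := by
      have h3 : s (piK ε μ) * (s a.2 * s (piK ε μ)) = s a.2 := by
        rw [← map_mul, ← map_mul, mul_left_comm, SGroup.mul_self, mul_one]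
      rw [← mul_assoc, hu.comm, smul_mul_assoc, mul_assoc u, ← mul_assoc (s a.2), h.comm_k,
        mul_assoc _ (s a.2), ← mul_assoc (s _), h.comm_k, mul_assoc _ (s _), h3]
    simp only [mul_smul_comm, smul_mul_assoc, mul_assoc, h2, smul_smul]
  rw [h1, hu.eq, smul_smul, ← smul_mul_assoc _ _ (s a.2), ← smul_mul_assoc _ _ (s a.2),
    mul_s_cancel]
  constructor
  · intro h2
    rw [h2, smul_smul, ht]
    congr 1
    linear_combination (d * t') * sgn_mul_self (a.1 (piK ε μ))
  · intro h2
    have h3 : d * sgn (a.1 (piK ε μ)) ≠ 0 := mul_ne_zero hd (sgn_ne_zero _)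
    rw [← smul_right_inj h3, h2, smul_smul, ht]
    congr 1
    linear_combination (-d * t') * sgn_mul_self (a.1 (piK ε μ))

/-- The group element of `F_j` has the extra factor `gK_j`, so the pairing of `E_i` with `F_j` is
that of `E_i` with `E_j` times `χ_i(gK_j)`. By symmetry only `(-1)^{p(i)p(j)}` remains, and the
commutator becomes the supercommutator. -/
theorem Twisted.tw_ef (h : Twisted X ε s φ ψ) (hn : 2 ≤ n) {i j : ℕ} (hi : i < n) (hj : j < n) :
    Tw s ((chi X ε i, gE X ε i) * (chi X ε j, gF X ε j))
      (cE X ε i * cF X ε j * sgn (chi X ε j (gE X ε i)))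
      (φ (fe i * ff j - ff j * fe i))
      (ψ (fe i * ff j - ((-1) ^ (p X ε i * p X ε j) : Kq) • (ff j * fe i))) := by
  have h1 := (h.tw_e i hi).br (h.tw_f j hj) 1 ((-1) ^ (p X ε i * p X ε j)) (by
    have h2 : pr (chi X ε i, gE X ε i) (chi X ε j, gF X ε j) = (-1) ^ (p X ε i * p X ε j) := by
      rw [pr, gF]
      simp only [map_mul]
      rw [← mul_assoc, chi_gE_mul X ε hn hi hj, chi_gK_comm X ε j i, mul_assoc,
        Int.units_mul_self, mul_one]
    rw [h2, map_pow, sgn_neg_one, ← mul_pow]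
    simp)
  simpa only [map_sub, map_mul, map_smul, br, one_smul] using h1

theorem Twisted.ef_iff (h : Twisted X ε s φ ψ) (hn : 2 ≤ n) {i j : ℕ} (hi : i < n)
    (hj : j < n) :
    φ (fe i * ff j - ff j * fe i) =
        φ (if i = j then (den X i)⁻¹ • (fk (α X i) - fk (-α X i)) else 0) ↔
      ψ (fe i * ff j - ((-1) ^ (p X ε i * p X ε j) : Kq) • (ff j * fe i)) =
        ψ (if i = j then ((-1) ^ (if i = 0 then eps ε 1 else eps ε i) * (den X i)⁻¹) •
          (fk (α X i) - fk (-α X i)) else 0) := by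
  have h1 := h.tw_ef hn hi hj
  by_cases hij : i = j
  · subst hij
    rw [if_pos rfl, if_pos rfl, h1.eq, cE_mul_cF, mul_smul, map_smul, map_smul ψ, map_smul ψ,
      map_sub ψ, h.eq_k, h.eq_k, piK_neg, piK_α X ε hn hi, ← sub_mul, ← map_sub,
      smul_right_inj (pow_ne_zero _ (neg_ne_zero.2 one_ne_zero)), ← smul_mul_assoc]
    -- The group elements of `E_i` and `F_i` multiply to that of `K_i`, and also to that of `K_i⁻¹`,
    -- so it can be cancelled on both sides.
    have h2 : ((chi X ε i, gE X ε i) * (chi X ε i, gF X ε i) : Weight n).2 = gK X ε i := by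
      change gE X ε i * (gE X ε i * gK X ε i) = _
      rw [← mul_assoc, SGroup.mul_self, one_mul]
    rw [h2, mul_s_cancel]
  · rw [if_neg hij, if_neg hij, map_zero, map_zero]
    exact h1.eq_zero_iff
      (mul_ne_zero (mul_ne_zero (cE_ne_zero X ε i) (cF_ne_zero X ε j)) (sgn_ne_zero _))

theorem Twisted.relations_iff (h : Twisted X ε s φ ψ) (hn : 4 ≤ n) :
    (∀ a b, GQRel X ε a b → φ a = φ b) ↔ ∀ a b, YQRel X ε a b → ψ a = ψ b := by
  have h2 : 2 ≤ n := by omega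
  have hke (i : ℕ) (hi : i < n) (μ : Wt n) :=
    h.conj_iff (h.tw_e i hi) (cE_ne_zero X ε i) μ (bq_eq X ε μ i)
  have hkf (i : ℕ) (hi : i < n) (μ : Wt n) :=
    h.conj_iff (h.tw_f i hi) (cF_ne_zero X ε i) μ (t := (bq ε μ (α X i))⁻¹)
      (t' := q ^ (-form ε μ (α X i))) (by
        rw [bq_eq, mul_inv, zpow_neg, inv_eq_of_mul_eq_one_left (sgn_mul_self _)])
  have hadd (μ ν : Wt n) : φ (fk (μ + ν)) = φ (fk μ) * φ (fk ν) ↔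
      ψ (fk (μ + ν)) = ψ (fk μ) * ψ (fk ν) := by
    rw [h.eq_k, h.eq_k, h.eq_k, mul_assoc (φ (fk μ)), ← mul_assoc (s _), h.comm_k, mul_assoc _ (s _),
      ← map_mul s, ← piK_add, ← mul_assoc, mul_s_cancel]
  have hse := (h.twFam_e h2).serre_relations_iff hn
  have hsf := (h.twFam_f h2).serre_relations_iff hn
  rw [← GQSerre.forall_map_iff, ← YQSerre.forall_map_iff] at hse hsf
  constructor
  · intro hφ a b hab
    cases hab with
    | k_zero => rw [h.eq_k, hφ _ _ .k_zero, piK_zero]; simp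
    | k_add μ ν =>
      rw [map_mul]
      exact (hadd μ ν).1 (by rw [hφ _ _ (.k_add μ ν), map_mul])
    | k_e i hi μ =>
      rw [map_mul, map_mul, map_smul]
      exact (hke i hi μ).1 (by simpa only [map_mul, map_smul] using hφ _ _ (.k_e i hi μ))
    | k_f i hi μ =>
      rw [map_mul, map_mul, map_smul]
      exact (hkf i hi μ).1 (by simpa only [map_mul, map_smul] using hφ _ _ (.k_f i hi μ))
    | e_f i j hi hj => exact (h.ef_iff h2 hi hj).1 (hφ _ _ (.e_f i j hi hj))
    | serre_e _ hr =>
      rw [map_zero]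
      exact hse.1 (fun r hr => by rw [hφ _ _ (.serre_e r hr), map_zero]) _ hr
    | serre_f _ hr =>
      rw [map_zero]
      exact hsf.1 (fun r hr => by rw [hφ _ _ (.serre_f r hr), map_zero]) _ hr
  · intro hψ a b hab
    cases hab with
    | k_zero =>
      have h3 := hψ _ _ .k_zero
      rwa [h.eq_k, piK_zero, map_one s, mul_one, map_one, ← map_one φ] at h3
    | k_add μ ν =>
      rw [map_mul]
      exact (hadd μ ν).2 (by rw [hψ _ _ (.k_add μ ν), map_mul])
    | k_e i hi μ =>
      rw [map_mul, map_mul, map_smul]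
      exact (hke i hi μ).2 (by simpa only [map_mul, map_smul] using hψ _ _ (.k_e i hi μ))
    | k_f i hi μ =>
      rw [map_mul, map_mul, map_smul]
      exact (hkf i hi μ).2 (by simpa only [map_mul, map_smul] using hψ _ _ (.k_f i hi μ))
    | e_f i j hi hj => exact (h.ef_iff h2 hi hj).2 (hψ _ _ (.e_f i j hi hj))
    | serre_e _ hr =>
      rw [map_zero]
      exact hse.2 (fun r hr => by rw [hψ _ _ (.serre_e r hr), map_zero]) _ hr
    | serre_f _ hr =>
      rw [map_zero]
      exact hsf.2 (fun r hr => by rw [hψ _ _ (.serre_f r hr), map_zero]) _ hr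

end Twisted

theorem fe_of_lt {i : ℕ} (hi : i < n) : (fe i : Free n) = FreeAlgebra.ι Kq (Gen.e ⟨i, hi⟩) :=
  dif_pos hi

theorem ff_of_lt {i : ℕ} (hi : i < n) : (ff i : Free n) = FreeAlgebra.ι Kq (Gen.f ⟨i, hi⟩) :=
  dif_pos hi

/-! ### Universal property of the semidirect product. -/

section Smash

variable {B : Type} [Ring B] [Algebra Kq B] {X : DType} {ε : Parity n} {s : SGroup n →* B}

theorem free_hom_ext {φ ψ : Free n →ₐ[Kq] B} (he : ∀ i < n, φ (fe i) = ψ (fe i))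
    (hf : ∀ i < n, φ (ff i) = ψ (ff i)) (hk : ∀ μ, φ (fk μ) = ψ (fk μ)) : φ = ψ := by
  refine FreeAlgebra.hom_ext (funext fun a => ?_)
  cases a with
  | e i => simpa only [fe_of_lt i.2, Function.comp_apply] using he i i.2
  | f i => simpa only [ff_of_lt i.2, Function.comp_apply] using hf i i.2
  | k μ => exact hk μ

/-- Compatibility of a homomorphism from the free algebra with a representation of the sign
group. -/
structure Graded (X : DType) (ε : Parity n) (s : SGroup n →* B) (φ : Free n →ₐ[Kq] B) :
    Prop where
  comm_e : ∀ i < n, ∀ g, s g * φ (fe i) = sgn (chi X ε i g) • (φ (fe i) * s g)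
  comm_f : ∀ i < n, ∀ g, s g * φ (ff i) = sgn (chi X ε i g) • (φ (ff i) * s g)
  comm_k : ∀ g μ, s g * φ (fk μ) = φ (fk μ) * s g

/-- Commutation with the sign group on generators propagates to all of the free algebra. This is the
compatibility needed to define a homomorphism on the semidirect product. -/
theorem Graded.twist_mul {φ : Free n →ₐ[Kq] B} (h : Graded X ε s φ) (g : SGroup n) (a : Free n) :
    φ (twist (fun i => chi X ε i g) a) * s g = s g * φ a := by
  induction a using FreeAlgebra.induction with
  | grade0 t => simp only [AlgHom.commutes, Algebra.commutes]
  | grade1 a =>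
    cases a with
    | e i =>
      rw [← fe_of_lt i.2, twist_fe, map_smul, h.comm_e i i.2, smul_mul_assoc, sgn_def]
    | f i =>
      rw [← ff_of_lt i.2, twist_ff, map_smul, h.comm_f i i.2, smul_mul_assoc, sgn_def]
    | k μ =>
      change φ (twist _ (fk μ)) * _ = _ * φ (fk μ)
      rw [twist_fk, h.comm_k]
  | mul a b ha hb => rw [map_mul, map_mul, mul_assoc, hb, ← mul_assoc, ha, mul_assoc, map_mul]
  | add a b ha hb => rw [map_add, map_add, add_mul, ha, hb, map_add, mul_add]

variable {r : Free n → Free n → Prop} [MulSemiringAction (SGroup n) (Pres r)]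
  [SMulCommClass (SGroup n) Kq (Pres r)]

/-- The homomorphism from the free algebra to the semidirect product. -/
def gens (r : Free n → Free n → Prop) [MulSemiringAction (SGroup n) (Pres r)]
    [SMulCommClass (SGroup n) Kq (Pres r)] :
    Free n →ₐ[Kq] SkewMonoidAlgebra (Pres r) (SGroup n) where
  __ := SkewMonoidAlgebra.singleOneRingHom.comp (Pres.mk r : Free n →+* Pres r)
  commutes' t := by
    change SkewMonoidAlgebra.single 1 (Pres.mk r (algebraMap Kq (Free n) t)) = _
    rw [AlgHom.commutes]
    rfl

theorem gens_apply (a : Free n) : gens r a = SkewMonoidAlgebra.single 1 (Pres.mk r a) := rfl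

theorem gens_rel {a b : Free n} (h : r a b) : gens r a = gens r b := by
  rw [gens_apply, gens_apply, Pres.mk_rel h]

theorem of_mul_gens (hact : ∀ (g : SGroup n) a, g • Pres.mk r a =
      Pres.mk r (twist (fun i => chi X ε i g) a)) (g : SGroup n) (a : Free n) :
    SkewMonoidAlgebra.of (Pres r) (SGroup n) g * gens r a =
      gens r (twist (fun i => chi X ε i g) a) * SkewMonoidAlgebra.of (Pres r) (SGroup n) g := by
  simp only [SkewMonoidAlgebra.of_apply, gens_apply, SkewMonoidAlgebra.single_mul_single, hact,
    one_mul, mul_one, smul_one]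

theorem graded_gens (hact : ∀ (g : SGroup n) a, g • Pres.mk r a =
      Pres.mk r (twist (fun i => chi X ε i g) a)) :
    Graded X ε (SkewMonoidAlgebra.of (Pres r) (SGroup n)) (gens r) where
  comm_e i _ g := by rw [of_mul_gens hact, twist_fe, map_smul, smul_mul_assoc, sgn_def]
  comm_f i _ g := by rw [of_mul_gens hact, twist_ff, map_smul, smul_mul_assoc, sgn_def]
  comm_k g μ := by rw [of_mul_gens hact, twist_fk]

/-- The universal property of the semidirect product. -/
def smashLift (hact : ∀ (g : SGroup n) a, g • Pres.mk r a =
      Pres.mk r (twist (fun i => chi X ε i g) a)) (φ : Free n →ₐ[Kq] B)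
    (hφ : ∀ a b, r a b → φ a = φ b) (h : Graded X ε s φ) :
    SkewMonoidAlgebra (Pres r) (SGroup n) →ₐ[Kq] B :=
  SkewMonoidAlgebra.liftNCAlgHom (Pres.lift φ hφ) s (by
    intro u g
    obtain ⟨a, rfl⟩ := Pres.mk_surjective r u
    rw [hact, Pres.lift_mk, Pres.lift_mk, h.twist_mul])

variable {hact : ∀ (g : SGroup n) a, g • Pres.mk r a =
      Pres.mk r (twist (fun i => chi X ε i g) a)} {φ : Free n →ₐ[Kq] B}
    {hφ : ∀ a b, r a b → φ a = φ b} {h : Graded X ε s φ}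

theorem smashLift_single (g : SGroup n) (a : Free n) :
    smashLift hact φ hφ h (SkewMonoidAlgebra.single g (Pres.mk r a)) = φ a * s g := by
  change SkewMonoidAlgebra.liftNC _ _ _ = _
  rw [SkewMonoidAlgebra.liftNC_single]
  congr 1
  exact Pres.lift_mk φ hφ a

theorem smashLift_gens (a : Free n) : smashLift hact φ hφ h (gens r a) = φ a := by
  rw [gens_apply, smashLift_single, map_one, mul_one]

theorem smashLift_of (g : SGroup n) :
    smashLift hact φ hφ h (SkewMonoidAlgebra.of (Pres r) (SGroup n) g) = s g := by
  rw [SkewMonoidAlgebra.of_apply, ← map_one (Pres.mk r), smashLift_single, map_one, one_mul]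

theorem smash_hom_ext {f f' : SkewMonoidAlgebra (Pres r) (SGroup n) →ₐ[Kq] B}
    (he : ∀ i < n, f (gens r (fe i)) = f' (gens r (fe i)))
    (hf : ∀ i < n, f (gens r (ff i)) = f' (gens r (ff i)))
    (hk : ∀ μ, f (gens r (fk μ)) = f' (gens r (fk μ)))
    (hs : ∀ g, f (SkewMonoidAlgebra.of (Pres r) (SGroup n) g) =
      f' (SkewMonoidAlgebra.of (Pres r) (SGroup n) g)) : f = f' := by
  have hg : f.comp (gens r) = f'.comp (gens r) := free_hom_ext he hf hk
  ext u
  induction u using SkewMonoidAlgebra.induction_on with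
  | zero => rw [map_zero, map_zero]
  | single g u =>
    obtain ⟨a, rfl⟩ := Pres.mk_surjective r u
    have h1 : SkewMonoidAlgebra.single g (Pres.mk r a) =
        gens r a * SkewMonoidAlgebra.of (Pres r) (SGroup n) g := by
      simp [gens_apply, SkewMonoidAlgebra.single_mul_single]
    rw [h1, map_mul, map_mul, hs]
    exact congrArg (· * _) (DFunLike.congr_fun hg a)
  | add u v hu hv => rw [map_add, map_add, hu, hv]

end Smash

/-! ### Twisting and untwisting a homomorphism. -/

section Twisting

variable {B : Type} [Ring B] [Algebra Kq B] {X : DType} {ε : Parity n} {s : SGroup n →* B}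
  {φ ψ : Free n →ₐ[Kq] B}

/-- The twist of a homomorphism from the free algebra, as in the definition of `τ`. -/
def twisted (X : DType) (ε : Parity n) (s : SGroup n →* B) (φ : Free n →ₐ[Kq] B) :
    Free n →ₐ[Kq] B :=
  FreeAlgebra.lift Kq fun
    | Gen.e i => cE X ε i • (φ (fe i) * s (gE X ε i))
    | Gen.f i => cF X ε i • (φ (ff i) * s (gF X ε i))
    | Gen.k μ => φ (fk μ) * s (piK ε μ)

/-- The inverse twist of a homomorphism from the free algebra. -/
def untwisted (X : DType) (ε : Parity n) (s : SGroup n →* B) (ψ : Free n →ₐ[Kq] B) :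
    Free n →ₐ[Kq] B :=
  FreeAlgebra.lift Kq fun
    | Gen.e i => (cE X ε i)⁻¹ • (ψ (fe i) * s (gE X ε i)⁻¹)
    | Gen.f i => (cF X ε i)⁻¹ • (ψ (ff i) * s (gF X ε i)⁻¹)
    | Gen.k μ => ψ (fk μ) * s (piK ε μ)⁻¹

theorem twisted_fe {i : ℕ} (hi : i < n) :
    twisted X ε s φ (fe i) = cE X ε i • (φ (fe i) * s (gE X ε i)) := by
  rw [fe_of_lt hi, twisted, FreeAlgebra.lift_ι_apply, ← fe_of_lt hi]

theorem twisted_ff {i : ℕ} (hi : i < n) :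
    twisted X ε s φ (ff i) = cF X ε i • (φ (ff i) * s (gF X ε i)) := by
  rw [ff_of_lt hi, twisted, FreeAlgebra.lift_ι_apply, ← ff_of_lt hi]

theorem twisted_fk (μ : Wt n) : twisted X ε s φ (fk μ) = φ (fk μ) * s (piK ε μ) :=
  FreeAlgebra.lift_ι_apply _ _

theorem untwisted_fe {i : ℕ} (hi : i < n) :
    untwisted X ε s ψ (fe i) = (cE X ε i)⁻¹ • (ψ (fe i) * s (gE X ε i)⁻¹) := by
  rw [fe_of_lt hi, untwisted, FreeAlgebra.lift_ι_apply, ← fe_of_lt hi]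

theorem untwisted_ff {i : ℕ} (hi : i < n) :
    untwisted X ε s ψ (ff i) = (cF X ε i)⁻¹ • (ψ (ff i) * s (gF X ε i)⁻¹) := by
  rw [ff_of_lt hi, untwisted, FreeAlgebra.lift_ι_apply, ← ff_of_lt hi]

theorem untwisted_fk (μ : Wt n) : untwisted X ε s ψ (fk μ) = ψ (fk μ) * s (piK ε μ)⁻¹ :=
  FreeAlgebra.lift_ι_apply _ _

theorem Graded.twisted (h : Graded X ε s φ) : Twisted X ε s φ (twisted X ε s φ) where
  tw_e i hi := ⟨h.comm_e i hi, twisted_fe hi⟩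
  tw_f i hi := ⟨h.comm_f i hi, twisted_ff hi⟩
  comm_k := h.comm_k
  eq_k := twisted_fk

theorem comm_mul_s (g g' : SGroup n) {u : B} {t : Kq} (h : s g * u = t • (u * s g)) :
    s g * (u * s g') = t • (u * s g' * s g) := by
  rw [← mul_assoc, h, smul_mul_assoc, mul_assoc, mul_assoc, ← map_mul, ← map_mul, mul_comm g]

theorem comm_smul_mul_s (g g' : SGroup n) {u : B} {t : Kq} (d : Kq)
    (h : s g * u = t • (u * s g)) :
    s g * (d • (u * s g')) = t • (d • (u * s g') * s g) := by
  rw [mul_smul_comm, comm_mul_s g g' h, smul_mul_assoc, smul_comm]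

/-- The relation `Twisted` can be solved for its left member as well as for its right one. This lets
the inverse of `τ` use the same equivalence of presentations, read backwards. -/
theorem Graded.untwisted (h : Graded X ε s ψ) : Twisted X ε s (untwisted X ε s ψ) ψ where
  tw_e i hi := by
    rw [untwisted_fe hi]
    exact Tw.symm (a := (chi X ε i, gE X ε i)) (h.comm_e i hi) (cE_ne_zero X ε i)
  tw_f i hi := by
    rw [untwisted_ff hi]
    exact Tw.symm (a := (chi X ε i, gF X ε i)) (h.comm_f i hi) (cF_ne_zero X ε i)
  comm_k g μ := by
    rw [untwisted_fk]
    have h1 := comm_mul_s (t := 1) g (piK ε μ)⁻¹ ((h.comm_k g μ).trans (one_smul Kq _).symm)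
    rwa [one_smul] at h1
  eq_k μ := by rw [untwisted_fk, mul_assoc, ← map_mul, inv_mul_cancel, map_one, mul_one]

theorem Twisted.graded_left (h : Twisted X ε s φ ψ) : Graded X ε s φ where
  comm_e i hi := (h.tw_e i hi).comm
  comm_f i hi := (h.tw_f i hi).comm
  comm_k := h.comm_k

theorem Twisted.graded_right (h : Twisted X ε s φ ψ) : Graded X ε s ψ where
  comm_e i hi g := by
    rw [(h.tw_e i hi).eq]
    exact comm_smul_mul_s g _ _ ((h.tw_e i hi).comm g)
  comm_f i hi g := by
    rw [(h.tw_f i hi).eq]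
    exact comm_smul_mul_s g _ _ ((h.tw_f i hi).comm g)
  comm_k g μ := by
    rw [h.eq_k]
    have h1 := comm_mul_s (t := 1) g (piK ε μ) ((h.comm_k g μ).trans (one_smul Kq _).symm)
    rwa [one_smul] at h1

end Twisting

/-! ### The map `τ` and its inverse on the full semidirect products. -/

variable (X : DType) (ε : Parity n)

theorem gq_smul_mk (g : SGroup n) (a : Free n) :
    g • Pres.mk (GQRel X ε) a = Pres.mk (GQRel X ε) (twist (fun i => chi X ε i g) a) :=
  actHom_mk X ε (gq_stable X ε) g a

theorem yq_smul_mk (g : SGroup n) (a : Free n) :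
    g • Pres.mk (YQRel X ε) a = Pres.mk (YQRel X ε) (twist (fun i => chi X ε i g) a) :=
  actHom_mk X ε (yq_stable X ε) g a

theorem gq_twisted :
    Twisted X ε (SkewMonoidAlgebra.of (GQ X ε) (SGroup n)) (gens (GQRel X ε))
      (twisted X ε (SkewMonoidAlgebra.of (GQ X ε) (SGroup n)) (gens (GQRel X ε))) :=
  (graded_gens (gq_smul_mk X ε)).twisted

theorem yq_untwisted :
    Twisted X ε (SkewMonoidAlgebra.of (YQ X ε) (SGroup n))
      (untwisted X ε (SkewMonoidAlgebra.of (YQ X ε) (SGroup n)) (gens (YQRel X ε)))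
      (gens (YQRel X ε)) :=
  (graded_gens (yq_smul_mk X ε)).untwisted

/-- The extension of `τ` to the semidirect products. -/
def tauHom (hn : 4 ≤ n) : YQσ X ε →ₐ[Kq] GQσ X ε :=
  smashLift (yq_smul_mk X ε)
    (twisted X ε (SkewMonoidAlgebra.of (GQ X ε) (SGroup n)) (gens (GQRel X ε)))
    (((gq_twisted X ε).relations_iff hn).1 fun _ _ h => gens_rel h) (gq_twisted X ε).graded_right

/-- The inverse of the extension of `τ` to the semidirect products. -/
def tauInv (hn : 4 ≤ n) : GQσ X ε →ₐ[Kq] YQσ X ε :=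
  smashLift (gq_smul_mk X ε)
    (untwisted X ε (SkewMonoidAlgebra.of (YQ X ε) (SGroup n)) (gens (YQRel X ε)))
    (((yq_untwisted X ε).relations_iff hn).2 fun _ _ h => gens_rel h)
    (yq_untwisted X ε).graded_left

variable {X ε}

theorem tauHom_gens (hn : 4 ≤ n) (a : Free n) : tauHom X ε hn (gens (YQRel X ε) a) =
    twisted X ε (SkewMonoidAlgebra.of (GQ X ε) (SGroup n)) (gens (GQRel X ε)) a :=
  smashLift_gens a

theorem tauInv_gens (hn : 4 ≤ n) (a : Free n) : tauInv X ε hn (gens (GQRel X ε) a) =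
    untwisted X ε (SkewMonoidAlgebra.of (YQ X ε) (SGroup n)) (gens (YQRel X ε)) a :=
  smashLift_gens a

theorem tauHom_of (hn : 4 ≤ n) (g : SGroup n) :
    tauHom X ε hn (SkewMonoidAlgebra.of (YQ X ε) (SGroup n) g) =
      SkewMonoidAlgebra.of (GQ X ε) (SGroup n) g :=
  smashLift_of g

theorem tauInv_of (hn : 4 ≤ n) (g : SGroup n) :
    tauInv X ε hn (SkewMonoidAlgebra.of (GQ X ε) (SGroup n) g) =
      SkewMonoidAlgebra.of (YQ X ε) (SGroup n) g :=
  smashLift_of g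

theorem tauHom_comp_tauInv (hn : 4 ≤ n) :
    (tauHom X ε hn).comp (tauInv X ε hn) = AlgHom.id Kq (GQσ X ε) := by
  refine smash_hom_ext ?_ ?_ ?_ ?_
  · intro i hi
    rw [AlgHom.comp_apply, tauInv_gens, untwisted_fe hi, map_smul, map_mul, tauHom_of, tauHom_gens,
      twisted_fe hi, smul_mul_assoc, mul_assoc, ← map_mul, mul_inv_cancel, map_one, mul_one,
      inv_smul_smul₀ (cE_ne_zero X ε i), AlgHom.id_apply]
  · intro i hi
    rw [AlgHom.comp_apply, tauInv_gens, untwisted_ff hi, map_smul, map_mul, tauHom_of, tauHom_gens,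
      twisted_ff hi, smul_mul_assoc, mul_assoc, ← map_mul, mul_inv_cancel, map_one, mul_one,
      inv_smul_smul₀ (cF_ne_zero X ε i), AlgHom.id_apply]
  · intro μ
    rw [AlgHom.comp_apply, tauInv_gens, untwisted_fk, map_mul, tauHom_of, tauHom_gens,
      twisted_fk, mul_assoc, ← map_mul, mul_inv_cancel, map_one, mul_one, AlgHom.id_apply]
  · intro g
    rw [AlgHom.comp_apply, tauInv_of, tauHom_of, AlgHom.id_apply]

theorem tauInv_comp_tauHom (hn : 4 ≤ n) :
    (tauInv X ε hn).comp (tauHom X ε hn) = AlgHom.id Kq (YQσ X ε) := by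
  refine smash_hom_ext ?_ ?_ ?_ ?_
  · intro i hi
    rw [AlgHom.comp_apply, tauHom_gens, twisted_fe hi, map_smul, map_mul, tauInv_of, tauInv_gens,
      untwisted_fe hi, smul_mul_assoc, mul_assoc, ← map_mul, inv_mul_cancel, map_one, mul_one,
      smul_inv_smul₀ (cE_ne_zero X ε i), AlgHom.id_apply]
  · intro i hi
    rw [AlgHom.comp_apply, tauHom_gens, twisted_ff hi, map_smul, map_mul, tauInv_of, tauInv_gens,
      untwisted_ff hi, smul_mul_assoc, mul_assoc, ← map_mul, inv_mul_cancel, map_one, mul_one,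
      smul_inv_smul₀ (cF_ne_zero X ε i), AlgHom.id_apply]
  · intro μ
    rw [AlgHom.comp_apply, tauHom_gens, twisted_fk, map_mul, tauInv_of, tauInv_gens,
      untwisted_fk, mul_assoc, ← map_mul, inv_mul_cancel, map_one, mul_one, AlgHom.id_apply]
  · intro g
    rw [AlgHom.comp_apply, tauHom_of, tauInv_of, AlgHom.id_apply]

/-- The extension of `τ` to the semidirect products, as an isomorphism. -/
def tauEquiv (X : DType) (ε : Parity n) (hn : 4 ≤ n) : YQσ X ε ≃ₐ[Kq] GQσ X ε :=
  AlgEquiv.ofAlgHom (tauHom X ε hn) (tauInv X ε hn) (tauHom_comp_tauInv hn) (tauInv_comp_tauHom hn)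

/-! ### The values of `τ` -/

theorem s_pow_eq (g : SGroup n) (m : ℕ) : s X ε g ^ m = s X ε (g ^ m) := (map_pow _ _ _).symm

theorem s_mul (g g' : SGroup n) : s X ε g * s X ε g' = s X ε (g * g') := (map_mul _ _ _).symm

theorem pow_pred_eq (g : SGroup n) {m : ℕ} (hm : 1 ≤ m) : g ^ (m - 1) = g ^ m * g := by
  obtain ⟨m, rfl⟩ : ∃ k, m = k + 1 := ⟨m - 1, by omega⟩
  rw [Nat.add_sub_cancel, pow_succ, mul_assoc, SGroup.mul_self, mul_one]

theorem tE_eq (X : DType) (ε : Parity n) (i m : ℕ) : tE X ε i m = e X ε i * s X ε (ePart ε m) := by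
  have s1 : s X ε 1 = 1 := map_one _
  unfold tE ePart
  rcases eps_zero_or_one ε m with h0 | h0 <;> rcases eps_zero_or_one ε (m + 1) with h1 | h1 <;>
    simp [h0, h1, s_pow_eq, s_mul, mul_assoc, s1]

theorem tK_eq (X : DType) (ε : Parity n) (i m : ℕ) : tK X ε i m = k X ε i * s X ε (kPart ε m) := by
  have s1 : s X ε 1 = 1 := map_one _
  unfold tK kPart
  split_ifs
  · rw [s1, mul_one]
  · rfl

/-- The prescribed exponent `m - blk ε m - 1` and the exponent `m - blk ε m + 1` coming from `ePart`
and `kPart` agree because `ς_m` is an involution. The truncated subtraction is harmless since `blk ε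
m < m`. -/
theorem tF_eq (X : DType) (ε : Parity n) (i : ℕ) {m : ℕ} (hm : 1 ≤ m) :
    tF X ε i m = fSign ε m • (f X ε i * s X ε (ePart ε m * kPart ε m)) := by
  have s1 : s X ε 1 = 1 := map_one _
  have hb := blk_lt ε hm
  unfold tF ePart kPart fSign
  rw [s_pow_eq, pow_pred_eq _ (show 1 ≤ m - blk ε m by omega)]
  rcases eps_zero_or_one ε m with h0 | h0 <;> rcases eps_zero_or_one ε (m + 1) with h1 | h1
  · simp [h0, h1, s1]
  · simp [h0, h1, s_mul, mul_assoc]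
  · rcases Nat.even_or_odd (m - blk ε m) with h2 | h2 <;>
      simp [h0, h1, s_mul, mul_assoc, h2.neg_one_pow]
  · simp [h0, h1]

theorem tauE_eq (i : ℕ) : tauE X ε i = cE X ε i • (e X ε i * s X ε (gE X ε i)) := by
  have s1 : s X ε 1 = 1 := map_one _
  rcases Nat.eq_zero_or_pos i with rfl | hi
  · cases X with
    | C =>
      change (-1) ^ eps ε 1 * e DType.C ε 0 = ((-1) ^ eps ε 1 : Kq) • (_ * s DType.C ε (gE _ _ _))
      rw [gE_C_zero, s1, mul_one]
      rcases eps_zero_or_one ε 1 with h | h <;> simp [h]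
    | D =>
      change tE DType.D ε 0 1 = (1 : Kq) • _
      rw [tE_eq, one_smul]; rfl
  · rw [show tauE X ε i = tE X ε i i from if_neg (by omega), tE_eq, cE_of_pos X ε hi, gE_of_pos X ε hi, one_smul]

theorem tauF_eq (i : ℕ) : tauF X ε i = cF X ε i • (f X ε i * s X ε (gF X ε i)) := by
  have s1 : s X ε 1 = 1 := map_one _
  rcases Nat.eq_zero_or_pos i with rfl | hi
  · cases X with
    | C =>
      change f DType.C ε 0 = (1 : Kq) • (_ * s DType.C ε (1 * 1))
      rw [one_mul, s1, mul_one, one_smul]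
    | D => exact tF_eq DType.D ε 0 le_rfl
  · rw [show tauF X ε i = tF X ε i i from if_neg (by omega), tF_eq X ε i hi, cF_of_pos X ε hi, gF, gE_of_pos X ε hi,
      gK_of_pos X ε hi]

theorem tauK_eq (i : ℕ) : tauK X ε i = k X ε i * s X ε (gK X ε i) := by
  have s1 : s X ε 1 = 1 := map_one _
  rcases Nat.eq_zero_or_pos i with rfl | hi
  · cases X with
    | C => rw [gK_C_zero, s1, mul_one]; rfl
    | D => exact tK_eq DType.D ε 0 1
  · rw [show tauK X ε i = tK X ε i i from if_neg (by omega), tK_eq, gK_of_pos X ε hi]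

theorem tauHom_E (hn : 4 ≤ n) {i : ℕ} (hi : i < n) : tauHom X ε hn (E X ε i) = tauE X ε i := by
  rw [tauE_eq]
  exact (tauHom_gens hn (fe i)).trans (twisted_fe hi)

theorem tauHom_F (hn : 4 ≤ n) {i : ℕ} (hi : i < n) : tauHom X ε hn (F X ε i) = tauF X ε i := by
  rw [tauF_eq]
  exact (tauHom_gens hn (ff i)).trans (twisted_ff hi)

theorem tauHom_K (hn : 4 ≤ n) {i : ℕ} (hi : i < n) : tauHom X ε hn (K X ε i) = tauK X ε i := by
  rw [tauK_eq, ← piK_α X ε (by omega) hi]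
  exact (tauHom_gens hn (fk (α X i))).trans (twisted_fk _)

theorem tauInv_e (hn : 4 ≤ n) {i : ℕ} (hi : i < n) :
    tauInv X ε hn (e X ε i) = (cE X ε i)⁻¹ • (E X ε i * S X ε (gE X ε i)⁻¹) :=
  (tauInv_gens hn (fe i)).trans (untwisted_fe hi)

theorem tauInv_f (hn : 4 ≤ n) {i : ℕ} (hi : i < n) :
    tauInv X ε hn (f X ε i) = (cF X ε i)⁻¹ • (F X ε i * S X ε (gF X ε i)⁻¹) :=
  (tauInv_gens hn (ff i)).trans (untwisted_ff hi)

theorem tauInv_k (hn : 4 ≤ n) (i : ℕ) :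
    tauInv X ε hn (k X ε i) = K X ε i * S X ε (piK ε (α X i))⁻¹ :=
  (tauInv_gens hn (fk (α X i))).trans (untwisted_fk _)

/-! ### Restriction to the subalgebras -/

/-- The `σ_j` generate the sign group, so both subalgebras contain all the group elements by which
`τ` and its inverse twist. -/
theorem SGroup.mem_of_sg_mem {M : Submonoid (SGroup n)} (h : ∀ j : Idx n, sg j ∈ M)
    (g : SGroup n) : g ∈ M := by
  rw [← Finset.univ_prod_mulSingle g]
  refine Submonoid.prod_mem _ fun j _ => ?_
  rcases Int.units_eq_one_or (g j) with h1 | h1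
  · rw [h1, Pi.mulSingle_one]; exact M.one_mem
  · convert h j using 1
    funext l
    rw [h1, Pi.mulSingle_apply, sg]
    simp only [Subtype.ext_iff]

theorem S_mem (g : SGroup n) : S X ε g ∈ scrX X ε :=
  SGroup.mem_of_sg_mem (M := (scrX X ε).toSubmonoid.comap
    (SkewMonoidAlgebra.of (YQ X ε) (SGroup n)))
    (fun j => Algebra.subset_adjoin (Or.inr ⟨j, rfl⟩)) g

theorem s_mem (g : SGroup n) : s X ε g ∈ scrY X ε :=
  SGroup.mem_of_sg_mem (M := (scrY X ε).toSubmonoid.comap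
    (SkewMonoidAlgebra.of (GQ X ε) (SGroup n)))
    (fun j => Algebra.subset_adjoin (Or.inr ⟨j, rfl⟩)) g

theorem scrX_le_comap (hn : 4 ≤ n) : scrX X ε ≤ (scrY X ε).comap (tauHom X ε hn) := by
  refine Algebra.adjoin_le ?_
  rintro _ (⟨i, hi, rfl | rfl | rfl⟩ | ⟨j, rfl⟩)
  · change tauHom X ε hn _ ∈ scrY X ε
    rw [tauHom_E hn hi, tauE_eq]
    exact (scrY X ε).smul_mem (mul_mem (Algebra.subset_adjoin (.inl ⟨i, hi, .inl rfl⟩)) (s_mem _)) _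
  · change tauHom X ε hn _ ∈ scrY X ε
    rw [tauHom_F hn hi, tauF_eq]
    exact (scrY X ε).smul_mem
      (mul_mem (Algebra.subset_adjoin (.inl ⟨i, hi, .inr (.inl rfl)⟩)) (s_mem _)) _
  · change tauHom X ε hn _ ∈ scrY X ε
    rw [tauHom_K hn hi, tauK_eq]
    exact mul_mem (Algebra.subset_adjoin (.inl ⟨i, hi, .inr (.inr rfl)⟩)) (s_mem _)
  · change tauHom X ε hn _ ∈ scrY X ε
    rw [S, tauHom_of]
    exact s_mem _

theorem scrY_le_comap (hn : 4 ≤ n) : scrY X ε ≤ (scrX X ε).comap (tauInv X ε hn) := by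
  refine Algebra.adjoin_le ?_
  rintro _ (⟨i, hi, rfl | rfl | rfl⟩ | ⟨j, rfl⟩)
  · change tauInv X ε hn _ ∈ scrX X ε
    rw [tauInv_e hn hi]
    exact (scrX X ε).smul_mem (mul_mem (Algebra.subset_adjoin (.inl ⟨i, hi, .inl rfl⟩)) (S_mem _)) _
  · change tauInv X ε hn _ ∈ scrX X ε
    rw [tauInv_f hn hi]
    exact (scrX X ε).smul_mem
      (mul_mem (Algebra.subset_adjoin (.inl ⟨i, hi, .inr (.inl rfl)⟩)) (S_mem _)) _
  · change tauInv X ε hn _ ∈ scrX X ε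
    rw [tauInv_k hn]
    exact mul_mem (Algebra.subset_adjoin (.inl ⟨i, hi, .inr (.inr rfl)⟩)) (S_mem _)
  · change tauInv X ε hn _ ∈ scrX X ε
    rw [s, tauInv_of]
    exact S_mem _

/-- One inclusion says that `τ` sends generators of `𝒳` into `𝒴`. The other says the same of the
inverse, with the two subalgebras exchanged. -/
theorem map_scrX (hn : 4 ≤ n) :
    (scrX X ε).map (tauEquiv X ε hn : YQσ X ε →ₐ[Kq] GQσ X ε) = scrY X ε := by
  refine le_antisymm (Subalgebra.map_le.2 (scrX_le_comap hn)) fun y hy => ?_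
  exact ⟨tauInv X ε hn y, scrY_le_comap hn hy, (tauEquiv X ε hn).apply_symm_apply y⟩

/-- The isomorphism `τ` from `𝒳` to `𝒴`. -/
def tau (X : DType) (ε : Parity n) (hn : 4 ≤ n) : scrX X ε ≃ₐ[Kq] scrY X ε :=
  ((tauEquiv X ε hn).subalgebraMap (scrX X ε)).trans (Subalgebra.equivOfEq _ _ (map_scrX hn))

end QOsp

end

theorem proposition2p1 (n : ℕ) (hn : 4 ≤ n) (X : QOsp.DType) (ε : QOsp.Parity n) :
    ∃ τ : QOsp.scrX X ε ≃ₐ[QOsp.Kq] QOsp.scrY X ε,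
      (∀ i : Fin n,
        (τ (QOsp.XE X ε i) : QOsp.GQσ X ε) = QOsp.tauE X ε i ∧
        (τ (QOsp.XF X ε i) : QOsp.GQσ X ε) = QOsp.tauF X ε i ∧
        (τ (QOsp.XK X ε i) : QOsp.GQσ X ε) = QOsp.tauK X ε i) ∧
      ∀ j : QOsp.Idx n, τ (QOsp.Xσ X ε j) = QOsp.Yσ X ε j := by
  refine ⟨QOsp.tau X ε hn, fun i => ⟨?_, ?_, ?_⟩, fun j => Subtype.ext ?_⟩
  · exact QOsp.tauHom_E hn i.2
  · exact QOsp.tauHom_F hn i.2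
  · exact QOsp.tauHom_K hn i.2
  · exact QOsp.tauHom_of hn _
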